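/- Let $n\ge 1$. Consider a half-space made of $n+1$ homogeneous layers: depths $0=H_1<H_2<\dots<H_{n+1}$ (and $H_{n+2}:=+\infty$), and constants $\mu_j,\rho_j>0$ for $1\le j\le n+1$, with $\mu(z)=\mu_j$, $\rho(z)=\rho_j$ for $z\in[H_j,H_{j+1})$. Put $C_j=\sqrt{\mu_j/\rho_j}$, $C(z)=\sqrt{\mu(z)/\rho(z)}$, $C_\infty=C_{n+1}$, $\mu_\infty=\mu_{n+1}$, $C_0=\min_j C_j$, $T_j=H_{j+1}-H_j$ for $1\le j\le n$, and let $\widetilde C_1\le\dots\le\widetilde C_{n+1}$ be the nondecreasing reordering, with multiplicity, of $C_1,\dots,C_{n+1}$. Assume $C_0<C_\infty$ and, if $n\ge 3$, also $C_0<\widetilde C_2$. A *Love wave exists at* $(\omega,k)$, where $\omega>0$ and $k\in\mathbb R$, if $k/\omega>1/C_\infty$ and there is a nonzero real-valued $\phi\in L^2((0,\infty))\cap\mathcal C([0,\infty))$ with $\lim_{z\to+\infty}\phi(z)=0$, $\mu\phi'\in\mathcal C([0,\infty))$, $\phi'(0)=0$ and $-(\mu\phi')'=\mu\,\omega^2\left(C^{-2}-k^2/\omega^2\right)\phi$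 on $[0,\infty)$ (the derivatives being taken away from the interfaces $H_2,\dots,H_{n+1}$). For $\omega>0$ and $k\ge 0$ let $\nu_j=C_j^{-1}\sqrt{C_j^2k^2-\omega^2}$ with $\operatorname{Im}\nu_j\le 0$ (and $\nu_j\geq 0$ if it is real), $\nu_\infty=\nu_{n+1}$, let $(P_0,Q_0)=(1,0)$ and, for $1\le m\le n$, $$\begin{pmatrix}P_m\\Q_m\end{pmatrix}=M_m\begin{pmatrix}P_{m-1}\\Q_{m-1}\end{pmatrix},\qquad M_m=\begin{pmatrix}\cosh(\nu_mT_m)&\dfrac{\sinh(\nu_mT_m)}{\mu_m\nu_m}\\ \mu_m\nu_m\sinh(\nu_mT_m)&\cosh(\nu_mT_m)\end{pmatrix}\ \text{if }\nu_m\ne0,\qquad M_m=\begin{pmatrix}1&T_m/\mu_m\\0&1\end{pmatrix}\ \text{if }\nu_m=0,$$ and let $f_n(\omega,k)=\mu_\infty\nu_\infty P_n+Q_n$. For $\ell\ge1$, let $k_\ell(\omega)$ denote the $\ell$-th largest of the distinct values $k\ge 0$ with $f_n(\omega,k)=0$, whenever it exists. Then there are numbers $\omega_\ell\ge 0$, $\ell\ge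 1$, such that for every $\ell\ge1$ the value $k_\ell(\omega)$ exists for all $\omega>\omega_\ell$, the function $$(\omega_\ell,+\infty)\to(1/C_\infty,1/C_0),\qquad \omega\mapsto k_\ell(\omega)/\omega$$ is (real-)analytic, bijective and strictly increasing, and, if $\omega_\ell>0$, then $k_\ell(\omega_\ell)$ exists and equals $\omega_\ell/C_\infty$. Moreover, for $\omega>0$ and $k\in\mathbb R$, a Love wave exists at $(\omega,k)$ if and only if $k=k_\ell(\omega)$ for some $\ell\ge1$ with $\omega>\omega_\ell$. -/

import Mathlib

open Set Filter Topology MeasureTheory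

/-- A half-space made of `n + 1` homogeneous layers, numbered `0, …, n` from the surface downwards.
Layer `j < n` occupies the depths `[H j, H (j+1))`, the last one occupies `[H n, ∞)`. -/
structure LayeredMedium (n : ℕ) where
  /-- shear modulus of each layer -/
  mu : Fin (n + 1) → ℝ
  /-- density of each layer -/
  rho : Fin (n + 1) → ℝ
  /-- depth of the top of each layer -/
  H : Fin (n + 1) → ℝ
  mu_pos : ∀ j, 0 < mu j
  rho_pos : ∀ j, 0 < rho j
  H_zero : H 0 = 0
  H_strictMono : StrictMono H

noncomputable section

namespace LayeredMedium

variable {n : ℕ} (M : LayeredMedium n)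

/-- The index of the layer that contains the depth `z ≥ 0`: the largest `j` with `H j ≤ z`. -/
def layerAt (z : ℝ) : Fin (n + 1) := (Finset.univ.filter fun j => M.H j ≤ z).sup id

/-- The shear modulus at depth `z`. -/
def muAt (z : ℝ) : ℝ := M.mu (M.layerAt z)

/-- The shear velocity of layer `j`. -/
def C (j : Fin (n + 1)) : ℝ := √(M.mu j / M.rho j)

/-- The shear velocity at depth `z`. -/
def CAt (z : ℝ) : ℝ := M.C (M.layerAt z)

/-- The smallest velocity. -/
def Czero : ℝ := Finset.univ.inf' Finset.univ_nonempty M.C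

/-- The velocity of the last, infinite, layer. -/
def Cinf : ℝ := M.C (Fin.last n)

/-- The nondecreasing reordering (with multiplicity) of the velocities; as indices start at `0`,
the second smallest velocity is `M.Csorted 1`. -/
def Csorted : Fin (n + 1) → ℝ := M.C ∘ Tuple.sort M.C

/-- The thickness of each of the first `n` layers. -/
def T (j : Fin n) : ℝ := M.H j.succ - M.H j.castSucc

/-- `ν_j = C_j⁻¹ √(C_j² k² - ω²)`, with the square root of nonpositive imaginary part. -/
def nu (ω k : ℝ) (j : Fin (n + 1)) : ℂ :=
  if 0 ≤ M.C j ^ 2 * k ^ 2 - ω ^ 2 then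
    ((M.C j)⁻¹ * √(M.C j ^ 2 * k ^ 2 - ω ^ 2) : ℝ)
  else
    -Complex.I * ((M.C j)⁻¹ * √(ω ^ 2 - M.C j ^ 2 * k ^ 2) : ℝ)

/-- The matrix that propagates (displacement, stress) through a layer of finite thickness. -/
def transfer (ω k : ℝ) (j : Fin n) : Matrix (Fin 2) (Fin 2) ℂ :=
  let ν : ℂ := M.nu ω k j.castSucc
  let m : ℂ := (M.mu j.castSucc : ℂ)
  let t : ℂ := (M.T j : ℂ)
  if ν = 0 then
    !![1, t / m;
       0, 1]
  else
    !![Complex.cosh (ν * t), Complex.sinh (ν * t) / (m * ν);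
       m * ν * Complex.sinh (ν * t), Complex.cosh (ν * t)]

/-- The vectors `(P_m, Q_m)`, `0 ≤ m ≤ n`: `(P_0, Q_0) = (1, 0)`, and `(P_m, Q_m)` is the image of
`(P_{m-1}, Q_{m-1})` under the matrix of the `m`-th layer from the surface. -/
def PQ (ω k : ℝ) : Fin (n + 1) → (Fin 2 → ℂ) :=
  Fin.induction (motive := fun _ => Fin 2 → ℂ) ![1, 0]
    (fun j v => (M.transfer ω k j).mulVec v)

/-- The dispersion function `f_n = μ_∞ ν_∞ P_n + Q_n`. -/
def dispersion (ω k : ℝ) : ℂ :=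
  (M.mu (Fin.last n) : ℂ) * M.nu ω k (Fin.last n) * M.PQ ω k (Fin.last n) 0
    + M.PQ ω k (Fin.last n) 1

/-- The wavenumbers `k ≥ 0` that solve the dispersion relation at frequency `ω`. -/
def dispersionZeros (ω : ℝ) : Set ℝ := {k | 0 ≤ k ∧ M.dispersion ω k = 0}

/-- `k` is the `ℓ`-th largest (`ℓ = 1, 2, …`) solution of the dispersion relation at `ω`. -/
def IsBranchValue (ℓ : ℕ) (ω k : ℝ) : Prop :=
  k ∈ M.dispersionZeros ω ∧ {k' ∈ M.dispersionZeros ω | k ≤ k'}.encard = (ℓ : ℕ∞)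

open Classical in
/-- `k_ℓ(ω)`: the `ℓ`-th largest solution of the dispersion relation at `ω`, with the value `0`
where it does not exist. -/
def kBranch (ℓ : ℕ) (ω : ℝ) : ℝ :=
  if h : ∃ k, M.IsBranchValue ℓ ω k then h.choose else 0

/-- `φ` is a Love mode at `(ω, k)`: a nonzero function in `L²(0, ∞)`, continuous on `[0, ∞)` and
vanishing at infinity, whose stress `σ = μ φ'` is continuous on `[0, ∞)`, with
`-(μ φ')' = μ ω² (1 / C² - k² / ω²) φ` and `φ'(0) = 0`, where `k / ω > 1 / C_∞`.
The two differential relations are classical away from the interfaces `H j`, `j ≠ 0`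
(where `φ'` may jump), and one-sided at the surface. -/
structure IsLoveMode (ω k : ℝ) (φ : ℝ → ℝ) : Prop where
  wavenumber : 1 / M.Cinf < k / ω
  nonzero : ∃ z, 0 ≤ z ∧ φ z ≠ 0
  memLp : MemLp φ 2 (volume.restrict (Ioi (0 : ℝ)))
  continuousOn : ContinuousOn φ (Ici 0)
  tendsto : Tendsto φ atTop (𝓝 0)
  surface : HasDerivWithinAt φ 0 (Ici 0) 0
  equation : ∃ σ : ℝ → ℝ, ContinuousOn σ (Ici 0) ∧
    ∀ z, 0 ≤ z → (∀ j, j ≠ 0 → z ≠ M.H j) →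
      (∃ d, HasDerivWithinAt φ d (Ici 0) z ∧ σ z = M.muAt z * d) ∧
      HasDerivWithinAt σ
        (-(M.muAt z * ω ^ 2 * (1 / M.CAt z ^ 2 - k ^ 2 / ω ^ 2) * φ z)) (Ici 0) z

/-- A Love wave exists at the frequency `ω` and the wavenumber `k`. -/
def LoveWaveExistsAt (ω k : ℝ) : Prop := ∃ φ : ℝ → ℝ, M.IsLoveMode ω k φ

end LayeredMedium

end

/-! Put s = k/ω and p = μP'/ω². In each layer the equation becomes P' = A p, p' = -B P, where ω
enters only A = ω²/μ and s enters only B = μ(C⁻² - s²). The proof is a Sturm oscillation argument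
for the continuous angle θ(ω, s) of P - ip at the top of the half-space (`angle`), lifted from the
value 0 at the surface. By Lagrange's identity (`wronskian_deriv_layerFlow`) its derivatives are
weighted integrals of p² and P²: θ is nondecreasing in ω ≥ 0 and, because n ≥ 1, strictly decreasing
in s ≥ 0.

For s ≥ 1/C_∞ the dispersion relation says that `phase`, which is θ - arctan(μ_∞ √(s² - C_∞⁻²)/ω),
is a multiple of π; for s < 1/C_∞ it has no solution (`dispersion_eq_zero_iff`). The phase always
exceeds -π and is negative at s = 1/C_0. Hence the zeros, from the largest down, are the solutions
of phase = 0, π, 2π, …, and k_ℓ/ω solves phase = (ℓ - 1)π (`isBranchValue_of_phase_eq`). It lies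
above 1/C_∞ exactly when the phase at 1/C_∞ exceeds (ℓ - 1)π, which defines `cutoff`.

Opposite monotonicity in ω and s makes the branch strictly increasing. It is onto because, at fixed
s inside the interval, the phase is negative for some small ω (`exists_phase_neg`) and unbounded
above (`exists_le_phase`): a slowest layer turns the angle by an amount linear in ω, while every
other layer loses less than π. Analyticity is the implicit function theorem. Finally, a mode is a
multiple of the solution shot from the surface, and the dispersion relation is the vanishing of its
growing exponential in the last layer (`loveWaveExistsAt_iff`). -/

noncomputable section

/-! ### The flow of one layer and Lagrange's identity -/

/-- The generator of the linear system `P' = A p`, `p' = -B P`. -/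
def layerGen (A B : ℝ) : (ℝ × ℝ) →L[ℝ] (ℝ × ℝ) :=
  A • (ContinuousLinearMap.inl ℝ ℝ ℝ ∘L ContinuousLinearMap.snd ℝ ℝ ℝ)
    - B • (ContinuousLinearMap.inr ℝ ℝ ℝ ∘L ContinuousLinearMap.fst ℝ ℝ ℝ)

/-- The flow of the linear system `P' = A p`, `p' = -B P`. -/
def layerFlow (A B z : ℝ) (u : ℝ × ℝ) : ℝ × ℝ := NormedSpace.exp (z • layerGen A B) u

/-- The vector `(P, p)` seen as the complex number `P - i p`. -/
def toComplex (u : ℝ × ℝ) : ℂ := ⟨u.1, -u.2⟩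

@[simp] lemma layerGen_apply (A B : ℝ) (u : ℝ × ℝ) : layerGen A B u = (A * u.2, -(B * u.1)) := by
  simp [layerGen]

lemma toComplex_ne_zero {u : ℝ × ℝ} : toComplex u ≠ 0 ↔ u ≠ 0 := by
  simp [toComplex, Complex.ext_iff, Prod.ext_iff]

@[fun_prop] lemma continuous_toComplex : Continuous toComplex := by
  have : toComplex = fun u : ℝ × ℝ => (u.1 : ℂ) - u.2 * Complex.I := by
    ext u
    apply Complex.ext <;> simp [toComplex]
  rw [this]
  fun_prop

lemma normSq_toComplex (u : ℝ × ℝ) : Complex.normSq (toComplex u) = u.1 ^ 2 + u.2 ^ 2 := by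
  simp [toComplex, Complex.normSq_apply]; ring

@[simp] lemma layerFlow_zero (A B : ℝ) (u : ℝ × ℝ) : layerFlow A B 0 u = u := by
  simp [layerFlow]

lemma layerFlow_ne_zero (A B z : ℝ) {u : ℝ × ℝ} (hu : u ≠ 0) : layerFlow A B z u ≠ 0 := by
  intro h
  apply hu
  have h2 : NormedSpace.exp (-(z • layerGen A B)) * NormedSpace.exp (z • layerGen A B) = 1 := by
    let _ : NormedAlgebra ℚ ((ℝ × ℝ) →L[ℝ] (ℝ × ℝ)) := NormedAlgebra.restrictScalars ℚ ℝ _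
    exact (NormedSpace.exp_add_of_commute
      (Commute.refl (z • layerGen A B)).neg_left).symm.trans (by simp)
  have h3 := congrArg (fun f : (ℝ × ℝ) →L[ℝ] (ℝ × ℝ) => f u) h2
  simp only [mul_apply_eq_comp, one_apply_eq_self] at h3
  rw [← h3]
  have : (NormedSpace.exp (z • layerGen A B)) u = 0 := h
  rw [this, map_zero]

lemma continuous_layerGen : Continuous fun q : ℝ × ℝ => layerGen q.1 q.2 := by
  unfold layerGen
  fun_prop

lemma Continuous.layer_flow {X : Type*} [TopologicalSpace X] {A B z : X → ℝ} {u : X → ℝ × ℝ}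
    (hA : Continuous A) (hB : Continuous B) (hz : Continuous z) (hu : Continuous u) :
    Continuous fun x => layerFlow (A x) (B x) (z x) (u x) := by
  have h1 : Continuous fun x => layerGen (A x) (B x) := continuous_layerGen.comp (hA.prodMk hB)
  have h2 : Continuous fun x => NormedSpace.exp (z x • layerGen (A x) (B x)) := by
    let _ : NormedAlgebra ℚ ((ℝ × ℝ) →L[ℝ] (ℝ × ℝ)) := NormedAlgebra.restrictScalars ℚ ℝ _
    exact NormedSpace.exp_continuous.comp (hz.smul h1)
  exact h2.clm_apply hu

lemma AnalyticAt.layer_flow {E : Type*} [NormedAddCommGroup E] [NormedSpace ℝ E]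
    {A B z : E → ℝ} {u : E → ℝ × ℝ} {x : E}
    (hA : AnalyticAt ℝ A x) (hB : AnalyticAt ℝ B x) (hz : AnalyticAt ℝ z x)
    (hu : AnalyticAt ℝ u x) :
    AnalyticAt ℝ (fun x => layerFlow (A x) (B x) (z x) (u x)) x := by
  have h1 : AnalyticAt ℝ (fun x => layerGen (A x) (B x)) x := by
    unfold layerGen
    exact (hA.smul analyticAt_const).sub (hB.smul analyticAt_const)
  have h2 : AnalyticAt ℝ (fun x => NormedSpace.exp (z x • layerGen (A x) (B x))) x :=
    (NormedSpace.exp_analytic (𝕂 := ℝ) _).comp (hz.smul h1)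
  exact (h2.contDiffAt.clm_apply (hu.contDiffAt (n := ⊤))).analyticAt

lemma HasDerivAt.comp_fst {u : ℝ → ℝ × ℝ} {u' : ℝ × ℝ} {t : ℝ} (hu : HasDerivAt u u' t) :
    HasDerivAt (fun t => (u t).1) u'.1 t :=
  (ContinuousLinearMap.fst ℝ ℝ ℝ).hasFDerivAt.comp_hasDerivAt t hu

lemma HasDerivAt.comp_snd {u : ℝ → ℝ × ℝ} {u' : ℝ × ℝ} {t : ℝ} (hu : HasDerivAt u u' t) :
    HasDerivAt (fun t => (u t).2) u'.2 t :=
  (ContinuousLinearMap.snd ℝ ℝ ℝ).hasFDerivAt.comp_hasDerivAt t hu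

lemma hasDerivAt_layerFlow (A B z : ℝ) (u : ℝ × ℝ) :
    HasDerivAt (fun z => layerFlow A B z u) (layerGen A B (layerFlow A B z u)) z := by
  have h := hasDerivAt_exp_smul_const' (𝕂 := ℝ) (layerGen A B) z
  exact (h.clm_apply (hasDerivAt_const z u)).congr_deriv (by simp [layerFlow])

lemma hasDerivAt_layerFlow_fst (A B z : ℝ) (u : ℝ × ℝ) :
    HasDerivAt (fun z => (layerFlow A B z u).1) (A * (layerFlow A B z u).2) z := by
  simpa using (hasDerivAt_layerFlow A B z u).comp_fst

lemma hasDerivAt_layerFlow_snd (A B z : ℝ) (u : ℝ × ℝ) :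
    HasDerivAt (fun z => (layerFlow A B z u).2) (-(B * (layerFlow A B z u).1)) z := by
  simpa using (hasDerivAt_layerFlow A B z u).comp_snd

lemma continuous_layerFlow (A B : ℝ) (u : ℝ × ℝ) : Continuous fun z => layerFlow A B z u :=
  Continuous.layer_flow continuous_const continuous_const continuous_id continuous_const

/-- Lagrange's identity for two solutions with different coefficients. -/
lemma wronskian_layerFlow (A₁ B₁ A₂ B₂ T : ℝ) (u₁ u₂ : ℝ × ℝ) :
    (layerFlow A₁ B₁ T u₁).2 * (layerFlow A₂ B₂ T u₂).1
        - (layerFlow A₁ B₁ T u₁).1 * (layerFlow A₂ B₂ T u₂).2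
      = u₁.2 * u₂.1 - u₁.1 * u₂.2
        + (A₂ - A₁) * (∫ z in (0 : ℝ)..T, (layerFlow A₁ B₁ z u₁).2 * (layerFlow A₂ B₂ z u₂).2)
        + (B₂ - B₁) * (∫ z in (0 : ℝ)..T, (layerFlow A₁ B₁ z u₁).1 * (layerFlow A₂ B₂ z u₂).1) := by
  have c1 := continuous_layerFlow A₁ B₁ u₁
  have c2 := continuous_layerFlow A₂ B₂ u₂
  have key := intervalIntegral.integral_eq_sub_of_hasDerivAt (a := 0) (b := T)
    (f := fun z => (layerFlow A₁ B₁ z u₁).2 * (layerFlow A₂ B₂ z u₂).1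
        - (layerFlow A₁ B₁ z u₁).1 * (layerFlow A₂ B₂ z u₂).2)
    (f' := fun z => (A₂ - A₁) * ((layerFlow A₁ B₁ z u₁).2 * (layerFlow A₂ B₂ z u₂).2)
        + (B₂ - B₁) * ((layerFlow A₁ B₁ z u₁).1 * (layerFlow A₂ B₂ z u₂).1))
    (fun z _ => by
      refine (((hasDerivAt_layerFlow_snd A₁ B₁ z u₁).mul (hasDerivAt_layerFlow_fst A₂ B₂ z u₂)).sub
        ((hasDerivAt_layerFlow_fst A₁ B₁ z u₁).mul
          (hasDerivAt_layerFlow_snd A₂ B₂ z u₂))).congr_deriv ?_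
      ring)
    (Continuous.intervalIntegrable (by fun_prop) _ _)
  rw [intervalIntegral.integral_add (Continuous.intervalIntegrable (by fun_prop) _ _)
    (Continuous.intervalIntegrable (by fun_prop) _ _), intervalIntegral.integral_const_mul,
    intervalIntegral.integral_const_mul] at key
  simp only [layerFlow_zero] at key
  linarith

/-- Mere continuity of the second factor suffices because the first one vanishes. This avoids
differentiating under the integral sign in the parameter formula below. -/
lemma HasDerivAt.mul_continuousAt_of_eq_zero {f g : ℝ → ℝ} {f' x : ℝ} (hf : HasDerivAt f f' x)
    (h0 : f x = 0) (hg : ContinuousAt g x) : HasDerivAt (fun y => f y * g y) (f' * g x) x := by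
  rw [hasDerivAt_iff_tendsto_slope] at hf ⊢
  have := hf.mul (hg.tendsto.mono_left (nhdsWithin_le_nhds (s := {x}ᶜ)))
  refine this.congr fun y => ?_
  simp [slope_def_field, h0]
  ring

/-- The derivative of a solution with respect to a parameter, in terms of the Wronskian. -/
lemma wronskian_deriv_layerFlow {A B : ℝ → ℝ} {u : ℝ → ℝ × ℝ} {A' B' t T : ℝ} {u' v' : ℝ × ℝ}
    (hA : HasDerivAt A A' t) (hB : HasDerivAt B B' t) (hu : HasDerivAt u u' t)
    (cA : Continuous A) (cB : Continuous B) (cu : Continuous u)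
    (hv : HasDerivAt (fun t => layerFlow (A t) (B t) T (u t)) v' t) :
    (layerFlow (A t) (B t) T (u t)).2 * v'.1 - (layerFlow (A t) (B t) T (u t)).1 * v'.2
      = (u t).2 * u'.1 - (u t).1 * u'.2
        + A' * (∫ z in (0 : ℝ)..T, (layerFlow (A t) (B t) z (u t)).2 ^ 2)
        + B' * (∫ z in (0 : ℝ)..T, (layerFlow (A t) (B t) z (u t)).1 ^ 2) := by
  have cont : Continuous fun q : ℝ × ℝ => layerFlow (A q.1) (B q.1) q.2 (u q.1) :=
    Continuous.layer_flow (cA.comp continuous_fst) (cB.comp continuous_fst) continuous_snd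
      (cu.comp continuous_fst)
  have cont0 : Continuous fun q : ℝ × ℝ => layerFlow (A t) (B t) q.2 (u t) :=
    (continuous_layerFlow _ _ _).comp continuous_snd
  have i1 : Continuous fun τ => ∫ z in (0 : ℝ)..T,
      (layerFlow (A t) (B t) z (u t)).2 * (layerFlow (A τ) (B τ) z (u τ)).2 :=
    intervalIntegral.continuous_parametric_intervalIntegral_of_continuous'
      (f := fun τ z => (layerFlow (A t) (B t) z (u t)).2 * (layerFlow (A τ) (B τ) z (u τ)).2)
      (cont0.snd.mul cont.snd) _ _
  have i2 : Continuous fun τ => ∫ z in (0 : ℝ)..T,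
      (layerFlow (A t) (B t) z (u t)).1 * (layerFlow (A τ) (B τ) z (u τ)).1 :=
    intervalIntegral.continuous_parametric_intervalIntegral_of_continuous'
      (f := fun τ z => (layerFlow (A t) (B t) z (u t)).1 * (layerFlow (A τ) (B τ) z (u τ)).1)
      (cont0.fst.mul cont.fst) _ _
  have l := (hv.comp_fst.const_mul (layerFlow (A t) (B t) T (u t)).2).sub
    (hv.comp_snd.const_mul (layerFlow (A t) (B t) T (u t)).1)
  have r := (((hu.comp_fst.const_mul (u t).2).sub (hu.comp_snd.const_mul (u t).1)).add
    ((hA.sub_const (A t)).mul_continuousAt_of_eq_zero (sub_self _) i1.continuousAt)).add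
    ((hB.sub_const (B t)).mul_continuousAt_of_eq_zero (sub_self _) i2.continuousAt)
  -- Lagrange's identity between the parameters t and τ is differentiated in τ at τ = t, where the
  -- coefficient differences vanish.
  have e := l.unique (r.congr_of_eventuallyEq (Eventually.of_forall fun τ => ?_))
  · simpa [sq] using e
  · simpa using wronskian_layerFlow (A t) (B t) (A τ) (B τ) T (u t) (u τ)

/-! ### The continuous logarithm along a layer and bounds on its rotation -/

/-- The increment of the complex logarithm of `P - i p` along a solution. -/
def logInc (A B T : ℝ) (u : ℝ × ℝ) : ℂ :=
  ∫ z in (0 : ℝ)..T, toComplex (layerGen A B (layerFlow A B z u)) / toComplex (layerFlow A B z u)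

lemma hasDerivAt_toComplex {u : ℝ → ℝ × ℝ} {u' : ℝ × ℝ} {t : ℝ} (hu : HasDerivAt u u' t) :
    HasDerivAt (fun t => toComplex (u t)) (toComplex u') t := by
  have h := hu.comp_fst.ofReal_comp.sub (hu.comp_snd.ofReal_comp.mul_const Complex.I)
  refine (h.congr_deriv ?_).congr_of_eventuallyEq (Eventually.of_forall fun t => ?_)
  · apply Complex.ext <;> simp [toComplex]
  · apply Complex.ext <;> simp [toComplex]

lemma continuous_logDeriv {X : Type*} [TopologicalSpace X] {A B z : X → ℝ} {u : X → ℝ × ℝ}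
    (hA : Continuous A) (hB : Continuous B) (hz : Continuous z) (hu : Continuous u)
    (h0 : ∀ x, u x ≠ 0) :
    Continuous fun x => toComplex (layerGen (A x) (B x) (layerFlow (A x) (B x) (z x) (u x))) /
      toComplex (layerFlow (A x) (B x) (z x) (u x)) := by
  have hf := hA.layer_flow hB hz hu
  have h1 : Continuous fun x => layerGen (A x) (B x) := continuous_layerGen.comp (hA.prodMk hB)
  exact (continuous_toComplex.comp (h1.clm_apply hf)).div (continuous_toComplex.comp hf)
    fun x => toComplex_ne_zero.2 (layerFlow_ne_zero _ _ _ (h0 x))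

lemma continuous_logDeriv_depth (A B : ℝ) {u : ℝ × ℝ} (hu : u ≠ 0) :
    Continuous fun z => toComplex (layerGen A B (layerFlow A B z u)) /
      toComplex (layerFlow A B z u) :=
  continuous_logDeriv continuous_const continuous_const continuous_id continuous_const fun _ => hu

lemma Continuous.log_inc {X : Type*} [TopologicalSpace X] {A B : X → ℝ} {T : ℝ}
    {u : X → ℝ × ℝ} (hA : Continuous A) (hB : Continuous B)
    (hu : Continuous u) (h0 : ∀ x, u x ≠ 0) :
    Continuous fun x => logInc (A x) (B x) T (u x) := by
  unfold logInc
  exact intervalIntegral.continuous_parametric_intervalIntegral_of_continuous'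
    (f := fun x z => toComplex (layerGen (A x) (B x) (layerFlow (A x) (B x) z (u x))) /
      toComplex (layerFlow (A x) (B x) z (u x)))
    (continuous_logDeriv (hA.comp continuous_fst) (hB.comp continuous_fst) continuous_snd
      (hu.comp continuous_fst) fun x => h0 x.1) _ _

lemma hasDerivAt_logInc (A B T : ℝ) {u : ℝ × ℝ} (hu : u ≠ 0) :
    HasDerivAt (fun z => logInc A B z u)
      (toComplex (layerGen A B (layerFlow A B T u)) / toComplex (layerFlow A B T u)) T := by
  have c := continuous_logDeriv_depth A B hu
  exact intervalIntegral.integral_hasDerivAt_right (c.intervalIntegrable _ _)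
    c.stronglyMeasurable.stronglyMeasurableAtFilter c.continuousAt

@[simp] lemma logInc_zero (A B : ℝ) (u : ℝ × ℝ) : logInc A B 0 u = 0 := by simp [logInc]

lemma toComplex_layerFlow (A B T : ℝ) {u : ℝ × ℝ} (hu : u ≠ 0) :
    toComplex (layerFlow A B T u) = toComplex u * Complex.exp (logInc A B T u) := by
  have key : ∀ z, HasDerivAt (fun z => toComplex (layerFlow A B z u) *
      Complex.exp (-logInc A B z u)) 0 z := fun z => by
    refine ((hasDerivAt_toComplex (hasDerivAt_layerFlow A B z u)).mul
      (hasDerivAt_logInc A B z hu).neg.cexp).congr_deriv ?_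
    have := toComplex_ne_zero.2 (layerFlow_ne_zero A B z hu)
    field_simp
    ring
  have h := is_const_of_deriv_eq_zero (fun z => (key z).differentiableAt)
    (fun z => (key z).deriv) T 0
  simp only [layerFlow_zero, logInc_zero, neg_zero, Complex.exp_zero, mul_one] at h
  rw [← h, mul_assoc, ← Complex.exp_add]
  simp


/-- By continuity Im L moves by less than π near the base point, so the principal logarithm inverts
the exponential there. A continuous lift thus inherits differentiability and analyticity from w. -/
lemma eventually_eq_log_of_mul_exp_eq {X : Type*} [TopologicalSpace X] {L w : X → ℂ} {c : ℂ}
    {x₀ : X} (hc : c ≠ 0) (hL : ContinuousAt L x₀) (hw : ∀ x, c * Complex.exp (L x) = w x) :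
    ∀ᶠ x in 𝓝 x₀, L x = L x₀ + Complex.log (w x / w x₀) := by
  have h1 : ContinuousAt (fun x => (L x - L x₀).im) x₀ :=
    Complex.continuous_im.continuousAt.comp (hL.sub continuousAt_const)
  have h2 : ∀ᶠ x in 𝓝 x₀, (L x - L x₀).im ∈ Ioo (-Real.pi) Real.pi := by
    refine h1.eventually (isOpen_Ioo.mem_nhds ?_)
    simp [Real.pi_pos]
  filter_upwards [h2] with x hx
  rw [← hw, ← hw, mul_div_mul_left _ _ hc, ← Complex.exp_sub, Complex.log_exp hx.1 hx.2.le]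
  ring

lemma ne_zero_of_mul_exp_eq {L w c : ℂ} (hc : c ≠ 0) (hw : c * Complex.exp L = w) : w ≠ 0 :=
  hw ▸ mul_ne_zero hc (Complex.exp_ne_zero _)

lemma hasDerivAt_of_mul_exp_eq {L w : ℝ → ℂ} {c w' : ℂ} {t : ℝ} (hc : c ≠ 0)
    (hL : ContinuousAt L t) (hw : ∀ x, c * Complex.exp (L x) = w x) (hw' : HasDerivAt w w' t) :
    HasDerivAt L (w' / w t) t := by
  have h0 := ne_zero_of_mul_exp_eq hc (hw t)
  have h1 : HasDerivAt (fun x => L t + Complex.log (w x / w t)) (w' / w t) t := by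
    have := ((hw'.div_const (w t)).clog_real (by simp [div_self h0])).const_add (L t)
    simpa [div_self h0] using this
  exact h1.congr_of_eventuallyEq (eventually_eq_log_of_mul_exp_eq hc hL hw)

lemma analyticAt_of_mul_exp_eq {E : Type*} [NormedAddCommGroup E] [NormedSpace ℝ E] {L w : E → ℂ}
    {c : ℂ} {x : E} (hc : c ≠ 0) (hL : ContinuousAt L x)
    (hw : ∀ x, c * Complex.exp (L x) = w x) (hw' : AnalyticAt ℝ w x) : AnalyticAt ℝ L x := by
  have h0 := ne_zero_of_mul_exp_eq hc (hw x)
  have h1 : AnalyticAt ℝ (fun y => w y / w x) x := hw'.div analyticAt_const h0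
  have h2 : AnalyticAt ℝ Complex.log 1 := (analyticAt_clog (by simp)).restrictScalars
  have h3 : AnalyticAt ℝ (fun y => L x + Complex.log (w y / w x)) x :=
    analyticAt_const.add (h2.comp_of_eq h1 (div_self h0))
  exact h3.congr ((eventually_eq_log_of_mul_exp_eq hc hL hw).mono fun _ h => h.symm)

/-- The numerator is the Wronskian, so the sign of a derivative of the angle is the sign of a
Wronskian. -/
lemma im_toComplex_div (u v : ℝ × ℝ) :
    (toComplex v / toComplex u).im = (u.2 * v.1 - u.1 * v.2) / (u.1 ^ 2 + u.2 ^ 2) := by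
  rw [Complex.div_im, normSq_toComplex]
  simp only [toComplex]
  ring

lemma sq_add_sq_pos {u : ℝ × ℝ} (hu : u ≠ 0) : 0 < u.1 ^ 2 + u.2 ^ 2 := by
  rw [← normSq_toComplex]
  exact Complex.normSq_pos.2 (toComplex_ne_zero.2 hu)

/-- The right half-plane avoids the branch cut, so the principal logarithm is a primitive. -/
lemma integral_logDeriv_of_re_pos {f f' : ℝ → ℂ} {T : ℝ} (hf : ∀ z, HasDerivAt f (f' z) z)
    (hT : 0 ≤ T) (hpos : ∀ z ∈ Icc 0 T, 0 < (f z).re)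
    (hint : IntervalIntegrable (fun z => f' z / f z) volume 0 T) :
    ∫ z in (0 : ℝ)..T, f' z / f z = Complex.log (f T) - Complex.log (f 0) := by
  refine intervalIntegral.integral_eq_sub_of_hasDerivAt (f := fun z => Complex.log (f z))
    (fun z hz => ?_) hint
  rw [uIcc_of_le hT] at hz
  exact (hf z).clog_real (Or.inl (hpos z hz))

lemma logInc_of_fst_pos {A B T : ℝ} {u : ℝ × ℝ} (hT : 0 ≤ T)
    (hpos : ∀ z ∈ Icc 0 T, 0 < (layerFlow A B z u).1) :
    logInc A B T u = Complex.log (toComplex (layerFlow A B T u)) - Complex.log (toComplex u) := by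
  have hu : u ≠ 0 := by
    rintro rfl
    simpa using hpos 0 ⟨le_rfl, hT⟩
  have := integral_logDeriv_of_re_pos
    (fun z => hasDerivAt_toComplex (hasDerivAt_layerFlow A B z u)) hT hpos
    ((continuous_logDeriv_depth A B hu).intervalIntegrable _ _)
  rwa [layerFlow_zero] at this

lemma layerFlow_zero_left_fst (B z : ℝ) (u : ℝ × ℝ) : (layerFlow 0 B z u).1 = u.1 := by
  have h := is_const_of_deriv_eq_zero
    (fun z => (hasDerivAt_layerFlow_fst 0 B z u).differentiableAt)
    (fun z => by simpa using (hasDerivAt_layerFlow_fst 0 B z u).deriv) z 0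
  simpa using h

lemma abs_arg_sub_arg_lt {z w : ℂ} (hz : 0 < z.re) (hw : 0 < w.re) :
    |z.arg - w.arg| < Real.pi := by
  have h1 := Complex.abs_arg_lt_pi_div_two_iff.2 (Or.inl hz)
  have h2 := Complex.abs_arg_lt_pi_div_two_iff.2 (Or.inl hw)
  rw [abs_lt] at *
  constructor <;> linarith

/-- When A = 0 the displacement is constant: P - ip moves on a vertical line, which lies in an open
half-plane unless P = 0. -/
lemma neg_pi_lt_im_logInc_zero (B : ℝ) {T : ℝ} {u : ℝ × ℝ} (hT : 0 ≤ T) (hu : u ≠ 0) :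
    -Real.pi < (logInc 0 B T u).im := by
  -- If P = 0 as well, the generator vanishes and the point does not move; otherwise division by P
  -- brings the line into the right half-plane without changing the logarithmic derivative.
  by_cases h0 : u.1 = 0
  · have : logInc 0 B T u = 0 := by
      have h : toComplex (0, 0) = 0 := by simp [toComplex, Complex.ext_iff]
      simp [logInc, layerFlow_zero_left_fst, h0, h]
    simp [this, Real.pi_pos]
  · have h1 : (u.1 : ℂ) ≠ 0 := by exact_mod_cast h0
    have hre : ∀ z, 0 < (toComplex (layerFlow 0 B z u) / u.1).re := fun z => by
      simp [toComplex, Complex.div_ofReal_re, layerFlow_zero_left_fst, h0]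
    have e : ∀ z, toComplex (layerGen 0 B (layerFlow 0 B z u)) / u.1 /
        (toComplex (layerFlow 0 B z u) / u.1) =
        toComplex (layerGen 0 B (layerFlow 0 B z u)) / toComplex (layerFlow 0 B z u) :=
      fun z => div_div_div_cancel_right₀ h1 _ _
    have key := integral_logDeriv_of_re_pos
      (fun z => (hasDerivAt_toComplex (hasDerivAt_layerFlow 0 B z u)).div_const (u.1 : ℂ)) hT
      (fun z _ => hre z) (by
        simp only [e]
        exact (continuous_logDeriv_depth 0 B hu).intervalIntegrable _ _)
    simp only [e] at key
    have := abs_lt.1 (abs_arg_sub_arg_lt (hre T) (hre 0))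
    rw [logInc, key, Complex.sub_im, Complex.log_im, Complex.log_im]
    exact this.1

/-- With B and the initial vector fixed, the Wronskian of the derivative in A is ∫ p². -/
lemma monotone_im_logInc (B : ℝ) {T : ℝ} {u : ℝ × ℝ} (hT : 0 ≤ T) (hu : u ≠ 0) :
    Monotone fun A => (logInc A B T u).im := by
  have hd : ∀ A, ∃ d, 0 ≤ d ∧ HasDerivAt (fun A => (logInc A B T u).im) d A := fun A => by
    have han : AnalyticAt ℝ (fun A => layerFlow A B T u) A :=
      AnalyticAt.layer_flow analyticAt_id analyticAt_const analyticAt_const analyticAt_const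
    have hv := han.differentiableAt.hasDerivAt
    have hW := wronskian_deriv_layerFlow (hasDerivAt_id A) (hasDerivAt_const A B)
      (hasDerivAt_const A u) continuous_id continuous_const continuous_const hv
    have hL := hasDerivAt_of_mul_exp_eq (toComplex_ne_zero.2 hu)
      (continuous_id.log_inc (T := T) continuous_const continuous_const fun _ => hu).continuousAt
      (fun A => (toComplex_layerFlow A B T hu).symm) (hasDerivAt_toComplex hv)
    have hI := Complex.imCLM.hasFDerivAt.comp_hasDerivAt A hL
    refine ⟨_, ?_, hI⟩
    rw [Complex.imCLM_apply, im_toComplex_div]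
    simp only [id_eq] at hW
    rw [hW]
    refine div_nonneg ?_ (by positivity)
    simpa using intervalIntegral.integral_nonneg hT fun _ _ => sq_nonneg _
  choose d hd0 hd using hd
  exact monotone_of_hasDerivAt_nonneg hd hd0

/-- Comparison with A = 0. No sign of B is required, so the bound also covers evanescent layers. -/
lemma neg_pi_lt_im_logInc {A : ℝ} (B : ℝ) {T : ℝ} {u : ℝ × ℝ} (hA : 0 ≤ A) (hT : 0 ≤ T)
    (hu : u ≠ 0) : -Real.pi < (logInc A B T u).im :=
  (neg_pi_lt_im_logInc_zero B hT hu).trans_le (monotone_im_logInc B hT hu hA)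

/-- The rescaled point v = √B P - i √A p rotates uniformly at speed √A √B. Since v/w stays in the
right half-plane, the rotations of v and of w = P - ip differ by less than π. -/
lemma sub_pi_lt_im_logInc {A B T : ℝ} {u : ℝ × ℝ} (hA : 0 < A) (hB : 0 < B) (hT : 0 ≤ T)
    (hu : u ≠ 0) : √A * √B * T - Real.pi < (logInc A B T u).im := by
  have hA' := Real.sqrt_pos.2 hA
  have hB' := Real.sqrt_pos.2 hB
  have hAA := Real.mul_self_sqrt hA.le
  have hBB := Real.mul_self_sqrt hB.le
  set a := √A
  set b := √B
  let w : ℝ → ℂ := fun z => toComplex (layerFlow A B z u)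
  let w' : ℝ → ℂ := fun z => toComplex (layerGen A B (layerFlow A B z u))
  let v : ℝ → ℂ := fun z => toComplex (b * (layerFlow A B z u).1, a * (layerFlow A B z u).2)
  have hw0 : ∀ z, w z ≠ 0 := fun z => toComplex_ne_zero.2 (layerFlow_ne_zero A B z hu)
  have hw : ∀ z, HasDerivAt w (w' z) z := fun z =>
    hasDerivAt_toComplex (hasDerivAt_layerFlow A B z u)
  have hv : ∀ z, HasDerivAt v (a * b * Complex.I * v z) z := fun z => by
    refine (hasDerivAt_toComplex (((hasDerivAt_layerFlow_fst A B z u).const_mul b).prodMk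
      ((hasDerivAt_layerFlow_snd A B z u).const_mul a))).congr_deriv ?_
    apply Complex.ext
    · simp [toComplex, v, ← hAA]; ring
    · simp [toComplex, v, ← hBB]; ring
  have hre : ∀ z, 0 < (v z / w z).re := fun z => by
    have hpos := sq_add_sq_pos (layerFlow_ne_zero A B z hu)
    rw [Complex.div_re, ← add_div, normSq_toComplex]
    refine div_pos ?_ hpos
    -- The real part of v times the conjugate of w is a positive definite quadratic form in (P, p).
    have : (v z).re * (w z).re + (v z).im * (w z).im =
        b * (layerFlow A B z u).1 ^ 2 + a * (layerFlow A B z u).2 ^ 2 := by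
      simp [v, w, toComplex]; ring
    rw [this]
    rcases (sq_nonneg (layerFlow A B z u).1).eq_or_lt with h | h
    · rw [← h] at hpos ⊢
      have : 0 < (layerFlow A B z u).2 ^ 2 := by linarith
      positivity
    · positivity
  have hv0 : ∀ z, v z ≠ 0 := fun z h => by simpa [h] using hre z
  have e : ∀ z, (a * b * Complex.I * v z * w z - v z * w' z) / w z ^ 2 / (v z / w z) =
      a * b * Complex.I - w' z / w z := fun z => by
    have := hw0 z
    have := hv0 z
    field_simp
  have c := continuous_logDeriv_depth A B hu
  have key := integral_logDeriv_of_re_pos (fun z => (hv z).div (hw z) (hw0 z)) hT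
    (fun z _ => hre z) (by
      have : Continuous fun z => (a * b * Complex.I - w' z / w z : ℂ) := continuous_const.sub c
      refine (this.intervalIntegrable 0 T).congr ?_
      exact fun z _ => (e z).symm)
  simp only [Pi.div_apply, e] at key
  rw [intervalIntegral.integral_sub (Continuous.intervalIntegrable (by fun_prop) _ _)
    (c.intervalIntegrable _ _), intervalIntegral.integral_const] at key
  have h := congrArg Complex.im key
  have hb := abs_lt.1 (abs_arg_sub_arg_lt (hre T) (hre 0))
  have hl : (∫ z in (0 : ℝ)..T, w' z / w z) = logInc A B T u := rfl
  rw [hl] at h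
  simp [Complex.log_im] at h
  linarith [hb.2]


/-! ### The angle of the layered medium -/

namespace LayeredMedium

variable {n : ℕ} (M : LayeredMedium n)

/-- The coefficient `ω² / μ_j` of the layer system `P' = A p`, `p' = -B P`. -/
def coefA (ω : ℝ) (j : Fin (n + 1)) : ℝ := ω ^ 2 / M.mu j

/-- The coefficient `μ_j (C_j⁻² - s²)` of the layer system `P' = A p`, `p' = -B P`, where `s` is the
slowness `k / ω`. -/
def coefB (s : ℝ) (j : Fin (n + 1)) : ℝ := M.mu j * (1 / M.C j ^ 2 - s ^ 2)

/-- Displacement and scaled stress `(P, p)`, `p = μ P' / ω²`, at the top of each layer. -/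
def state (ω s : ℝ) : Fin (n + 1) → ℝ × ℝ :=
  Fin.induction (motive := fun _ => ℝ × ℝ) (1, 0)
    (fun j u => layerFlow (M.coefA ω j.castSucc) (M.coefB s j.castSucc) (M.T j) u)

/-- The complex logarithm of `P - i p` at the top of each layer, continued from the surface. -/
def logState (ω s : ℝ) : Fin (n + 1) → ℂ :=
  Fin.induction (motive := fun _ => ℂ) 0
    (fun j L => L + logInc (M.coefA ω j.castSucc) (M.coefB s j.castSucc) (M.T j)
      (M.state ω s j.castSucc))

@[simp] lemma state_zero (ω s : ℝ) : M.state ω s 0 = (1, 0) := rfl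

lemma state_succ (ω s : ℝ) (j : Fin n) : M.state ω s j.succ =
    layerFlow (M.coefA ω j.castSucc) (M.coefB s j.castSucc) (M.T j) (M.state ω s j.castSucc) :=
  Fin.induction_succ ..

@[simp] lemma logState_zero (ω s : ℝ) : M.logState ω s 0 = 0 := rfl

lemma logState_succ (ω s : ℝ) (j : Fin n) : M.logState ω s j.succ = M.logState ω s j.castSucc +
    logInc (M.coefA ω j.castSucc) (M.coefB s j.castSucc) (M.T j) (M.state ω s j.castSucc) :=
  Fin.induction_succ ..

attribute [irreducible] state logState

lemma T_pos (j : Fin n) : 0 < M.T j := sub_pos.2 (M.H_strictMono j.castSucc_lt_succ)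

lemma C_pos (j : Fin (n + 1)) : 0 < M.C j := Real.sqrt_pos.2 (div_pos (M.mu_pos j) (M.rho_pos j))

lemma Cinf_pos : 0 < M.Cinf := M.C_pos _

lemma Czero_le (j : Fin (n + 1)) : M.Czero ≤ M.C j := Finset.inf'_le _ (Finset.mem_univ j)

lemma exists_C_eq_Czero : ∃ j, M.C j = M.Czero := by
  obtain ⟨j, -, hj⟩ := Finset.exists_mem_eq_inf' Finset.univ_nonempty M.C
  exact ⟨j, hj.symm⟩

lemma Czero_pos : 0 < M.Czero := by
  obtain ⟨j, hj⟩ := M.exists_C_eq_Czero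
  exact hj ▸ M.C_pos j

lemma coefA_nonneg (ω : ℝ) (j : Fin (n + 1)) : 0 ≤ M.coefA ω j :=
  div_nonneg (sq_nonneg _) (M.mu_pos j).le

lemma coefB_nonpos {s : ℝ} (hs : 1 / M.Czero ≤ s) (j : Fin (n + 1)) : M.coefB s j ≤ 0 := by
  refine mul_nonpos_of_nonneg_of_nonpos (M.mu_pos j).le (sub_nonpos.2 ?_)
  rw [← one_div_pow]
  refine pow_le_pow_left₀ (one_div_nonneg.2 (M.C_pos j).le) (le_trans ?_ hs) 2
  exact one_div_le_one_div_of_le M.Czero_pos (M.Czero_le j)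

lemma state_ne_zero (ω s : ℝ) (j : Fin (n + 1)) : M.state ω s j ≠ 0 := by
  induction j using Fin.induction with
  | zero => simp
  | succ j ih =>
    rw [state_succ]
    exact layerFlow_ne_zero _ _ _ ih

lemma continuous_coefA (j : Fin (n + 1)) : Continuous fun ω => M.coefA ω j := by
  unfold coefA
  fun_prop

lemma continuous_coefB (j : Fin (n + 1)) : Continuous fun s => M.coefB s j := by
  unfold coefB
  fun_prop

lemma continuous_state (j : Fin (n + 1)) : Continuous fun q : ℝ × ℝ => M.state q.1 q.2 j := by
  induction j using Fin.induction with
  | zero => simpa only [state_zero] using continuous_const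
  | succ j ih =>
    simp only [state_succ]
    exact ((M.continuous_coefA _).comp continuous_fst).layer_flow
      ((M.continuous_coefB _).comp continuous_snd) continuous_const ih

lemma analyticAt_state (j : Fin (n + 1)) (q : ℝ × ℝ) :
    AnalyticAt ℝ (fun q : ℝ × ℝ => M.state q.1 q.2 j) q := by
  induction j using Fin.induction with
  | zero => simpa only [state_zero] using analyticAt_const
  | succ j ih =>
    simp only [state_succ]
    refine AnalyticAt.layer_flow ?_ ?_ analyticAt_const ih
    · exact (analyticAt_fst.pow 2).div_const
    · exact analyticAt_const.mul (analyticAt_const.sub (analyticAt_snd.pow 2))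

lemma continuous_logState (j : Fin (n + 1)) :
    Continuous fun q : ℝ × ℝ => M.logState q.1 q.2 j := by
  induction j using Fin.induction with
  | zero => simpa only [logState_zero] using continuous_const
  | succ j ih =>
    simp only [logState_succ]
    exact ih.add (((M.continuous_coefA _).comp continuous_fst).log_inc
      ((M.continuous_coefB _).comp continuous_snd) (M.continuous_state _)
      fun q => M.state_ne_zero _ _ _)

lemma exp_logState (ω s : ℝ) (j : Fin (n + 1)) :
    Complex.exp (M.logState ω s j) = toComplex (M.state ω s j) := by
  induction j using Fin.induction with
  | zero => apply Complex.ext <;> simp [toComplex]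
  | succ j ih =>
    rw [state_succ, logState_succ, Complex.exp_add, ih,
      toComplex_layerFlow _ _ _ (M.state_ne_zero _ _ _)]

/-- The continuous angle of `P - i p` at the top of the last layer. -/
def angle (ω s : ℝ) : ℝ := (M.logState ω s (Fin.last n)).im

lemma continuous_angle : Continuous fun q : ℝ × ℝ => M.angle q.1 q.2 :=
  Complex.continuous_im.comp (M.continuous_logState _)

/-- The angle is the imaginary part of a continuous logarithm of the analytic, nowhere zero function
P - ip. -/
lemma analyticAt_angle (q : ℝ × ℝ) : AnalyticAt ℝ (fun q : ℝ × ℝ => M.angle q.1 q.2) q := by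
  have hs := M.analyticAt_state (Fin.last n) q
  have hw : AnalyticAt ℝ (fun q : ℝ × ℝ => toComplex (M.state q.1 q.2 (Fin.last n))) q := by
    have h1 : AnalyticAt ℝ (fun q : ℝ × ℝ => (M.state q.1 q.2 (Fin.last n)).1) q :=
      analyticAt_fst.comp hs
    have h2 : AnalyticAt ℝ (fun q : ℝ × ℝ => (M.state q.1 q.2 (Fin.last n)).2) q :=
      analyticAt_snd.comp hs
    have h3 := ((Complex.ofRealCLM.analyticAt _).comp h1).sub
      (((Complex.ofRealCLM.analyticAt _).comp h2).mul (analyticAt_const (v := Complex.I)))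
    refine h3.congr (Eventually.of_forall fun q => ?_)
    apply Complex.ext <;> simp [toComplex]
  have hL := analyticAt_of_mul_exp_eq one_ne_zero (M.continuous_logState (Fin.last n)).continuousAt
    (fun q => (one_mul _).trans (M.exp_logState q.1 q.2 _)) hw
  exact (Complex.imCLM.analyticAt _).comp hL

/-- If P stays positive, the curve never leaves the right half-plane and the increments of the
principal logarithm telescope. This fixes the lift in the two reference regimes, ω = 0 and s ≥
1/C_0. -/
lemma angle_eq_arg {ω s : ℝ}
    (hpos : ∀ j : Fin n, ∀ z ∈ Icc 0 (M.T j), 0 < (layerFlow (M.coefA ω j.castSucc)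
      (M.coefB s j.castSucc) z (M.state ω s j.castSucc)).1) :
    M.angle ω s = (toComplex (M.state ω s (Fin.last n))).arg := by
  have : ∀ j, M.logState ω s j = Complex.log (toComplex (M.state ω s j)) := fun j => by
    induction j using Fin.induction with
    | zero =>
      have : toComplex (1, 0) = 1 := by apply Complex.ext <;> simp [toComplex]
      simp [this]
    | succ j ih =>
      rw [logState_succ, ih, logInc_of_fst_pos (M.T_pos j).le (hpos j), state_succ]
      ring
  rw [angle, this, Complex.log_im]

lemma state_fst_zero_left (s : ℝ) (j : Fin (n + 1)) : (M.state 0 s j).1 = 1 := by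
  induction j using Fin.induction with
  | zero => simp
  | succ j ih =>
    rw [state_succ, ← ih]
    simp [coefA, layerFlow_zero_left_fst]

/-- At ω = 0 all the A vanish, so P = 1 throughout. -/
lemma abs_angle_zero_left_lt (s : ℝ) : |M.angle 0 s| < Real.pi / 2 := by
  rw [angle_eq_arg, Complex.abs_arg_lt_pi_div_two_iff]
  · left
    simp [toComplex, state_fst_zero_left]
  · intro j z _
    simp [coefA, layerFlow_zero_left_fst, state_fst_zero_left]

end LayeredMedium

/-- Since (P p)' = A p² - B P² ≥ 0, the product P p stays nonnegative; then (P²)' = 2 A P p ≥ 0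
keeps P away from zero. -/
lemma layerFlow_pos {A B : ℝ} {u : ℝ × ℝ} (hA : 0 ≤ A) (hB : B ≤ 0) (h1 : 0 < u.1)
    (h2 : 0 ≤ u.2) {z : ℝ} (hz : 0 ≤ z) :
    0 < (layerFlow A B z u).1 ∧ 0 ≤ (layerFlow A B z u).2 := by
  have c := continuous_layerFlow A B u
  have m1 : Monotone fun z => (layerFlow A B z u).1 * (layerFlow A B z u).2 := by
    refine monotone_of_hasDerivAt_nonneg (fun z => (hasDerivAt_layerFlow_fst A B z u).mul
      (hasDerivAt_layerFlow_snd A B z u)) fun z => ?_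
    have e1 := mul_nonneg hA (sq_nonneg (layerFlow A B z u).2)
    have e2 := mul_nonneg (neg_nonneg.2 hB) (sq_nonneg (layerFlow A B z u).1)
    simp only [Pi.zero_apply]
    linarith
  have p1 : ∀ z, 0 ≤ z → 0 ≤ (layerFlow A B z u).1 * (layerFlow A B z u).2 := fun z hz => by
    have := m1 hz
    simp only [layerFlow_zero] at this
    exact (mul_nonneg h1.le h2).trans this
  have m2 : MonotoneOn (fun z => (layerFlow A B z u).1 ^ 2) (Ici 0) := by
    refine monotoneOn_of_deriv_nonneg (convex_Ici 0) (by fun_prop)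
      (fun z _ => ((hasDerivAt_layerFlow_fst A B z u).pow 2).differentiableAt.differentiableWithinAt)
      fun z hz => ?_
    rw [interior_Ici] at hz
    have hd : HasDerivAt (fun z => (layerFlow A B z u).1 ^ 2) _ z :=
      (hasDerivAt_layerFlow_fst A B z u).pow 2
    rw [hd.deriv]
    have := mul_nonneg hA (p1 z hz.le)
    simp only [Nat.cast_ofNat, Nat.add_one_sub_one, pow_one]
    linarith
  have nz : ∀ z, 0 ≤ z → (layerFlow A B z u).1 ≠ 0 := fun z hz h => by
    have := m2 (mem_Ici.2 le_rfl) (mem_Ici.2 hz) hz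
    simp only [layerFlow_zero, h] at this
    nlinarith
  have hp : 0 < (layerFlow A B z u).1 := by
    by_contra! hneg
    have := intermediate_value_Icc' hz (f := fun z => (layerFlow A B z u).1) (by fun_prop)
    obtain ⟨y, hy, hy0⟩ := this ⟨hneg, by simpa using h1.le⟩
    exact nz y hy.1 hy0
  exact ⟨hp, nonneg_of_mul_nonneg_right (p1 z hz) hp⟩

namespace LayeredMedium

variable {n : ℕ} (M : LayeredMedium n)

lemma state_pos {s : ℝ} (hs : 1 / M.Czero ≤ s) (ω : ℝ) (j : Fin (n + 1)) :
    0 < (M.state ω s j).1 ∧ 0 ≤ (M.state ω s j).2 := by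
  induction j using Fin.induction with
  | zero => simp
  | succ j ih =>
    rw [state_succ]
    exact layerFlow_pos (M.coefA_nonneg _ _) (M.coefB_nonpos hs _) ih.1 ih.2 (M.T_pos j).le

lemma angle_nonpos {s : ℝ} (hs : 1 / M.Czero ≤ s) (ω : ℝ) : M.angle ω s ≤ 0 := by
  have h := M.state_pos hs ω
  rw [angle_eq_arg]
  · rw [Complex.arg_of_re_nonneg (h _).1.le]
    exact Real.arcsin_nonpos.2 (div_nonpos_of_nonpos_of_nonneg (neg_nonpos.2 (h _).2)
      (norm_nonneg _))
  · exact fun j z hz => (layerFlow_pos (M.coefA_nonneg _ _) (M.coefB_nonpos hs _)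
      (h _).1 (h _).2 hz.1).1

/-! ### Monotonicity and growth of the angle -/

/-- The Wronskian of the state with its derivative along a curve of parameters. -/
lemma wronskian_deriv_state_succ {a b : ℝ → ℝ} {a' b' t : ℝ} (ca : Continuous a)
    (cb : Continuous b) {j : Fin n} {u' v' : ℝ × ℝ}
    (hA : HasDerivAt (fun t => M.coefA (a t) j.castSucc) a' t)
    (hB : HasDerivAt (fun t => M.coefB (b t) j.castSucc) b' t)
    (hu : HasDerivAt (fun t => M.state (a t) (b t) j.castSucc) u' t)
    (hv : HasDerivAt (fun t => M.state (a t) (b t) j.succ) v' t) :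
    (M.state (a t) (b t) j.succ).2 * v'.1 - (M.state (a t) (b t) j.succ).1 * v'.2 =
      (M.state (a t) (b t) j.castSucc).2 * u'.1 - (M.state (a t) (b t) j.castSucc).1 * u'.2
      + a' * (∫ z in (0 : ℝ)..M.T j, (layerFlow (M.coefA (a t) j.castSucc)
          (M.coefB (b t) j.castSucc) z (M.state (a t) (b t) j.castSucc)).2 ^ 2)
      + b' * (∫ z in (0 : ℝ)..M.T j, (layerFlow (M.coefA (a t) j.castSucc)
          (M.coefB (b t) j.castSucc) z (M.state (a t) (b t) j.castSucc)).1 ^ 2) := by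
  simp only [state_succ] at hv ⊢
  exact wronskian_deriv_layerFlow (A := fun t => M.coefA (a t) j.castSucc)
    (B := fun t => M.coefB (b t) j.castSucc) (u := fun t => M.state (a t) (b t) j.castSucc)
    hA hB hu ((M.continuous_coefA _).comp ca)
    ((M.continuous_coefB _).comp cb) ((M.continuous_state _).comp (ca.prodMk cb)) hv

lemma differentiable_state (j : Fin (n + 1)) :
    Differentiable ℝ fun q : ℝ × ℝ => M.state q.1 q.2 j :=
  fun q => (M.analyticAt_state j q).differentiableAt

lemma hasDerivAt_state_left (ω s : ℝ) (j : Fin (n + 1)) :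
    HasDerivAt (fun ω => M.state ω s j) (deriv (fun ω => M.state ω s j) ω) ω := by
  have : DifferentiableAt ℝ (fun ω => M.state ω s j) ω :=
    DifferentiableAt.comp ω (g := fun q : ℝ × ℝ => M.state q.1 q.2 j) (f := fun ω => (ω, s))
      (M.differentiable_state j (ω, s)) (differentiableAt_id.prodMk (differentiableAt_const s))
  exact this.hasDerivAt

lemma hasDerivAt_state_right (ω s : ℝ) (j : Fin (n + 1)) :
    HasDerivAt (fun s => M.state ω s j) (deriv (fun s => M.state ω s j) s) s := by
  have : DifferentiableAt ℝ (fun s => M.state ω s j) s :=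
    DifferentiableAt.comp s (g := fun q : ℝ × ℝ => M.state q.1 q.2 j) (f := fun s => (ω, s))
      (M.differentiable_state j (ω, s)) ((differentiableAt_const ω).prodMk differentiableAt_id)
  exact this.hasDerivAt

/-- Each layer adds (2ω/μ) ∫ p², as ω enters only the coefficient A. -/
lemma wronskian_left_nonneg {ω : ℝ} (hω : 0 ≤ ω) (s : ℝ) (j : Fin (n + 1)) :
    0 ≤ (M.state ω s j).2 * (deriv (fun ω => M.state ω s j) ω).1 -
      (M.state ω s j).1 * (deriv (fun ω => M.state ω s j) ω).2 := by
  induction j using Fin.induction with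
  | zero => simp
  | succ j ih =>
    have hA : HasDerivAt (fun ω => M.coefA ω j.castSucc) (2 * ω / M.mu j.castSucc) ω := by
      unfold coefA
      simpa using (hasDerivAt_pow 2 ω).div_const (M.mu j.castSucc)
    have key := M.wronskian_deriv_state_succ continuous_id continuous_const hA
      (hasDerivAt_const _ (M.coefB s j.castSucc))
      (M.hasDerivAt_state_left ω s _) (M.hasDerivAt_state_left ω s _)
    simp only [id_eq, zero_mul, add_zero] at key
    rw [key]
    have h1 := (M.mu_pos j.castSucc).le
    have h2 := intervalIntegral.integral_nonneg (μ := volume) (M.T_pos j).le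
      fun z _ => sq_nonneg (layerFlow (M.coefA ω j.castSucc) (M.coefB s j.castSucc) z
        (M.state ω s j.castSucc)).2
    exact add_nonneg ih (mul_nonneg (by positivity) h2)

/-- Each layer adds -2 s μ ∫ P². The weak inequality carries the induction from the surface, where
the state does not depend on s. -/
lemma wronskian_right_neg {s : ℝ} (hs : 0 < s) (ω : ℝ) (j : Fin (n + 1)) :
    (M.state ω s j).2 * (deriv (fun s => M.state ω s j) s).1 -
      (M.state ω s j).1 * (deriv (fun s => M.state ω s j) s).2 ≤ 0 ∧
    (j ≠ 0 → (M.state ω s j).2 * (deriv (fun s => M.state ω s j) s).1 -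
      (M.state ω s j).1 * (deriv (fun s => M.state ω s j) s).2 < 0) := by
  induction j using Fin.induction with
  | zero => simp
  | succ j ih =>
    have hB : HasDerivAt (fun s => M.coefB s j.castSucc) (-(M.mu j.castSucc * (2 * s))) s := by
      unfold coefB
      exact (((hasDerivAt_pow 2 s).const_sub (1 / M.C j.castSucc ^ 2)).const_mul
        (M.mu j.castSucc)).congr_deriv (by simp)
    have key := M.wronskian_deriv_state_succ continuous_const continuous_id
      (hasDerivAt_const _ (M.coefA ω j.castSucc)) hB
      (M.hasDerivAt_state_right ω s _) (M.hasDerivAt_state_right ω s _)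
    simp only [id_eq, zero_mul, add_zero] at key
    have h1 : 0 < M.mu j.castSucc * (2 * s) := mul_pos (M.mu_pos _) (by linarith)
    have h2 := intervalIntegral.integral_nonneg (μ := volume) (M.T_pos j).le
      fun z _ => sq_nonneg (layerFlow (M.coefA ω j.castSucc) (M.coefB s j.castSucc) z
        (M.state ω s j.castSucc)).1
    have h3 := mul_nonneg h1.le h2
    rw [key]
    refine ⟨by linarith [ih.1], fun _ => ?_⟩
    -- Strictness originates in the surface layer, where P = 1 at the top makes ∫ P² positive;
    -- deeper layers inherit it.
    rcases eq_or_ne j.castSucc 0 with h0 | h0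
    · have c := continuous_layerFlow (M.coefA ω j.castSucc) (M.coefB s j.castSucc)
        (M.state ω s j.castSucc)
      have h4 := intervalIntegral.integral_pos (M.T_pos j)
        (f := fun z => (layerFlow (M.coefA ω j.castSucc) (M.coefB s j.castSucc) z
          (M.state ω s j.castSucc)).1 ^ 2) (by fun_prop) (fun z _ => sq_nonneg _)
        ⟨0, ⟨le_rfl, (M.T_pos j).le⟩, by rw [layerFlow_zero, h0]; simp⟩
      have h5 := mul_pos h1 h4
      linarith [ih.1]
    · linarith [ih.2 h0]

lemma hasDerivAt_angle_left (ω s : ℝ) :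
    HasDerivAt (fun ω => M.angle ω s)
      (((M.state ω s (Fin.last n)).2 * (deriv (fun ω => M.state ω s (Fin.last n)) ω).1 -
        (M.state ω s (Fin.last n)).1 * (deriv (fun ω => M.state ω s (Fin.last n)) ω).2) /
        ((M.state ω s (Fin.last n)).1 ^ 2 + (M.state ω s (Fin.last n)).2 ^ 2)) ω := by
  rw [← im_toComplex_div]
  exact Complex.imCLM.hasFDerivAt.comp_hasDerivAt ω (hasDerivAt_of_mul_exp_eq
    (L := fun ω => M.logState ω s (Fin.last n)) one_ne_zero
    ((M.continuous_logState _).comp (continuous_id.prodMk continuous_const)).continuousAt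
    (fun ω => (one_mul _).trans (M.exp_logState ω s _))
    (hasDerivAt_toComplex (M.hasDerivAt_state_left ω s _)))

lemma hasDerivAt_angle_right (ω s : ℝ) :
    HasDerivAt (fun s => M.angle ω s)
      (((M.state ω s (Fin.last n)).2 * (deriv (fun s => M.state ω s (Fin.last n)) s).1 -
        (M.state ω s (Fin.last n)).1 * (deriv (fun s => M.state ω s (Fin.last n)) s).2) /
        ((M.state ω s (Fin.last n)).1 ^ 2 + (M.state ω s (Fin.last n)).2 ^ 2)) s := by
  rw [← im_toComplex_div]
  exact Complex.imCLM.hasFDerivAt.comp_hasDerivAt s (hasDerivAt_of_mul_exp_eq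
    (L := fun s => M.logState ω s (Fin.last n)) one_ne_zero
    ((M.continuous_logState _).comp (continuous_const.prodMk continuous_id)).continuousAt
    (fun s => (one_mul _).trans (M.exp_logState ω s _))
    (hasDerivAt_toComplex (M.hasDerivAt_state_right ω s _)))

lemma angle_monotoneOn (s : ℝ) : MonotoneOn (fun ω => M.angle ω s) (Ici 0) := by
  refine monotoneOn_of_deriv_nonneg (convex_Ici 0)
    (M.continuous_angle.comp (continuous_id.prodMk continuous_const)).continuousOn
    (fun ω _ => (M.hasDerivAt_angle_left ω s).differentiableAt.differentiableWithinAt)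
    fun ω hω => ?_
  rw [interior_Ici] at hω
  rw [(M.hasDerivAt_angle_left ω s).deriv]
  exact div_nonneg (M.wronskian_left_nonneg (le_of_lt hω) s _) (by positivity)

lemma exists_hasDerivAt_angle_neg (hn : 1 ≤ n) (ω : ℝ) {s : ℝ} (hs : 0 < s) :
    ∃ d < 0, HasDerivAt (fun s => M.angle ω s) d s := by
  refine ⟨_, ?_, M.hasDerivAt_angle_right ω s⟩
  refine div_neg_of_neg_of_pos ((M.wronskian_right_neg hs ω _).2 ?_)
    (sq_add_sq_pos (M.state_ne_zero _ _ _))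
  rw [Ne, Fin.ext_iff]
  simp
  omega

lemma angle_strictAntiOn (hn : 1 ≤ n) (ω : ℝ) : StrictAntiOn (fun s => M.angle ω s) (Ici 0) := by
  refine strictAntiOn_of_deriv_neg (convex_Ici 0)
    (M.continuous_angle.comp (continuous_const.prodMk continuous_id)).continuousOn fun s hs => ?_
  rw [interior_Ici] at hs
  obtain ⟨d, hd, h⟩ := M.exists_hasDerivAt_angle_neg hn ω hs
  rwa [h.deriv]

lemma neg_pi_div_two_lt_angle {ω : ℝ} (hω : 0 ≤ ω) (s : ℝ) : -(Real.pi / 2) < M.angle ω s :=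
  (abs_lt.1 (M.abs_angle_zero_left_lt s)).1.trans_le
    (M.angle_monotoneOn s (mem_Ici.2 le_rfl) (mem_Ici.2 hω) hω)

/-- A slowest layer cannot be the last one because C_0 < C_∞, so it has finite thickness, and it is
oscillatory for s < 1/C_0. -/
lemma exists_coefB_pos (hC : M.Czero < M.Cinf) {s : ℝ} (hs0 : 0 ≤ s) (hs : s < 1 / M.Czero) :
    ∃ j : Fin n, 0 < M.coefB s j.castSucc := by
  obtain ⟨j, hj⟩ := M.exists_C_eq_Czero
  have hl : j ≠ Fin.last n := by
    rintro rfl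
    exact hC.ne' hj
  obtain ⟨i, rfl⟩ := Fin.exists_castSucc_eq.2 hl
  refine ⟨i, mul_pos (M.mu_pos _) (sub_pos.2 ?_)⟩
  rw [hj, ← one_div_pow]
  exact pow_lt_pow_left₀ hs hs0 two_ne_zero

/-- Every layer costs at most π, and crossing the oscillatory layer i gains √A √B T. -/
lemma im_logState_ge {ω s : ℝ} (hω : 0 < ω) {i : Fin n} (hi : 0 < M.coefB s i.castSucc)
    (j : Fin (n + 1)) :
    (if i.castSucc < j then
      √(M.coefA ω i.castSucc) * √(M.coefB s i.castSucc) * M.T i else 0) - j * Real.pi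
      ≤ (M.logState ω s j).im := by
  induction j using Fin.induction with
  | zero => simp
  | succ j ih =>
    rw [logState_succ, Complex.add_im]
    have h0 := neg_pi_lt_im_logInc (M.coefB s j.castSucc) (M.coefA_nonneg ω j.castSucc)
      (M.T_pos j).le (M.state_ne_zero ω s j.castSucc)
    simp only [Fin.val_castSucc, Fin.val_succ, Nat.cast_add, Nat.cast_one] at ih ⊢
    rcases lt_trichotomy i j with h | h | h
    · have h1 : i.castSucc < j.castSucc := h
      have h2 : i.castSucc < j.succ := h1.trans j.castSucc_lt_succ
      rw [if_pos h1] at ih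
      rw [if_pos h2]
      linarith
    · subst h
      rw [if_neg (lt_irrefl _)] at ih
      rw [if_pos i.castSucc_lt_succ]
      have := sub_pi_lt_im_logInc (div_pos (pow_pos hω 2) (M.mu_pos i.castSucc)) hi
        (M.T_pos i).le (M.state_ne_zero ω s i.castSucc)
      simp only [coefA] at this ih ⊢
      linarith
    · have h2 : ¬ i.castSucc < j.succ := by
        rw [Fin.lt_def] at h ⊢
        simp
        omega
      have h1 : ¬ i.castSucc < j.castSucc := fun h' => h2 (h'.trans j.castSucc_lt_succ)
      rw [if_neg h1] at ih
      rw [if_neg h2]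
      linarith

lemma exists_le_angle (hC : M.Czero < M.Cinf) {s : ℝ} (hs0 : 0 ≤ s) (hs : s < 1 / M.Czero)
    (N : ℝ) : ∃ ω, 0 < ω ∧ N ≤ M.angle ω s := by
  obtain ⟨i, hi⟩ := M.exists_coefB_pos hC hs0 hs
  set K := √(M.coefB s i.castSucc) * M.T i / √(M.mu i.castSucc) with hK
  have hKpos : 0 < K := by
    have := M.T_pos i
    have := M.mu_pos i.castSucc
    positivity
  -- At this ω the gain of layer i is |N| + nπ + 1: nπ pays for the n layers, and the final 1 makes
  -- ω positive.
  refine ⟨(|N| + n * Real.pi + 1) / K, by positivity, ?_⟩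
  set ω := (|N| + n * Real.pi + 1) / K with hω
  have hω0 : 0 < ω := by positivity
  have h := M.im_logState_ge hω0 hi (Fin.last n)
  rw [if_pos i.castSucc_lt_last, coefA, Real.sqrt_div (sq_nonneg _), Real.sqrt_sq hω0.le] at h
  have e : ω / √(M.mu i.castSucc) * √(M.coefB s i.castSucc) * M.T i = |N| + n * Real.pi + 1 := by
    rw [← div_mul_cancel₀ (|N| + n * Real.pi + 1) hKpos.ne', ← hω, hK]
    ring
  rw [e] at h
  simp only [Fin.val_last] at h
  have := le_abs_self N
  unfold angle
  linarith

end LayeredMedium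

/-! ### The dispersion function in terms of the angle -/

/-- The solution of `P' = Q / m`, `Q' = m ν² P` in terms of hyperbolic functions. -/
lemma eq_cosh_sinh_of_hasDerivAt {P Q : ℝ → ℂ} {m ν : ℂ} (hm : m ≠ 0) (hν : ν ≠ 0)
    (hP : ∀ z, HasDerivAt P (Q z / m) z) (hQ : ∀ z, HasDerivAt Q (m * ν ^ 2 * P z) z) (T : ℝ) :
    P T = Complex.cosh (ν * T) * P 0 + Complex.sinh (ν * T) / (m * ν) * Q 0 ∧
    Q T = m * ν * Complex.sinh (ν * T) * P 0 + Complex.cosh (ν * T) * Q 0 := by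
  have hl : ∀ z : ℝ, HasDerivAt (fun z : ℝ => ν * (z : ℂ)) ν z := fun z => by
    simpa using (Complex.ofRealCLM.hasDerivAt (x := z)).const_mul ν
  have hc : ∀ z : ℝ, HasDerivAt (fun z : ℝ => Complex.cosh (ν * z)) (Complex.sinh (ν * z) * ν) z :=
    fun z => (Complex.hasDerivAt_cosh (ν * z)).comp (h₂ := Complex.cosh) z (hl z)
  have hs : ∀ z : ℝ, HasDerivAt (fun z : ℝ => Complex.sinh (ν * z)) (Complex.cosh (ν * z) * ν) z :=
    fun z => (Complex.hasDerivAt_sinh (ν * z)).comp (h₂ := Complex.sinh) z (hl z)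
  -- The inverse propagator applied to the solution is constant; cosh² - sinh² = 1 then solves for P
  -- and Q.
  have h1 : ∀ z : ℝ, HasDerivAt (fun z : ℝ => Complex.cosh (ν * z) * P z -
      Complex.sinh (ν * z) / (m * ν) * Q z) 0 z := fun z => by
    refine (((hc z).mul (hP z)).sub (((hs z).div_const _).mul (hQ z))).congr_deriv ?_
    field_simp
    ring
  have h2 : ∀ z : ℝ, HasDerivAt (fun z : ℝ => Complex.cosh (ν * z) * Q z -
      m * ν * Complex.sinh (ν * z) * P z) 0 z := fun z => by
    refine (((hc z).mul (hQ z)).sub (((hs z).const_mul (m * ν)).mul (hP z))).congr_deriv ?_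
    field_simp
    ring
  have e1 := is_const_of_deriv_eq_zero (fun z => (h1 z).differentiableAt)
    (fun z => (h1 z).deriv) T 0
  have e2 := is_const_of_deriv_eq_zero (fun z => (h2 z).differentiableAt)
    (fun z => (h2 z).deriv) T 0
  have e3 := Complex.cosh_sq (ν * T)
  simp only [Complex.ofReal_zero, mul_zero, Complex.cosh_zero, Complex.sinh_zero, one_mul,
    zero_div, zero_mul, sub_zero] at e1 e2
  rw [← e1, ← e2]
  constructor
  · field_simp
    linear_combination (-P T * ν * m) * e3
  · field_simp
    linear_combination (-Q T) * e3

lemma eq_affine_of_hasDerivAt {P Q : ℝ → ℂ} {m : ℂ}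
    (hP : ∀ z, HasDerivAt P (Q z / m) z) (hQ : ∀ z, HasDerivAt Q 0 z) (T : ℝ) :
    P T = P 0 + T / m * Q 0 ∧ Q T = Q 0 := by
  have e := is_const_of_deriv_eq_zero (fun z => (hQ z).differentiableAt) (fun z => (hQ z).deriv)
  have h1 : ∀ z : ℝ, HasDerivAt (fun z : ℝ => P z - z / m * Q z) 0 z := fun z => by
    refine ((hP z).sub (((Complex.ofRealCLM.hasDerivAt (x := z)).div_const m).mul
      (hQ z))).congr_deriv ?_
    simp
    ring
  have e1 := is_const_of_deriv_eq_zero (fun z => (h1 z).differentiableAt)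
    (fun z => (h1 z).deriv) T 0
  refine ⟨?_, e T 0⟩
  rw [e T 0] at e1
  simp at e1
  linear_combination e1

namespace LayeredMedium

variable {n : ℕ} (M : LayeredMedium n)

/-- The transfer matrices are even in ν, so the finite layers see only ν², and the choice of root
matters only for ν_∞. -/
lemma nu_sq (ω k : ℝ) (j : Fin (n + 1)) :
    M.nu ω k j ^ 2 = ((k ^ 2 - ω ^ 2 / M.C j ^ 2 : ℝ) : ℂ) := by
  have hC := (M.C_pos j).ne'
  have hC' : (M.C j : ℂ) ≠ 0 := by exact_mod_cast hC
  unfold nu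
  split_ifs with h
  · have := Real.sq_sqrt h
    rw [← Complex.ofReal_pow, mul_pow, this]
    congr 1
    field_simp
  · have := Real.sq_sqrt (show 0 ≤ ω ^ 2 - M.C j ^ 2 * k ^ 2 by linarith)
    rw [mul_pow, neg_sq, Complex.I_sq, ← Complex.ofReal_pow, mul_pow, this]
    push_cast
    field_simp
    ring

/-- The unscaled stress is Q = ω² p, and (P, Q) solves the system with coefficients 1/μ and μν². -/
lemma transfer_mulVec {ω : ℝ} (hω : ω ≠ 0) (k : ℝ) (j : Fin n) (u : ℝ × ℝ) :
    (M.transfer ω k j).mulVec ![(u.1 : ℂ), ((ω ^ 2 * u.2 : ℝ) : ℂ)] =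
      ![((layerFlow (M.coefA ω j.castSucc) (M.coefB (k / ω) j.castSucc) (M.T j) u).1 : ℂ),
        ((ω ^ 2 * (layerFlow (M.coefA ω j.castSucc) (M.coefB (k / ω) j.castSucc) (M.T j) u).2 : ℝ) :
          ℂ)] := by
  set f := fun z : ℝ => layerFlow (M.coefA ω j.castSucc) (M.coefB (k / ω) j.castSucc) z u with hf
  have hm : (M.mu j.castSucc : ℂ) ≠ 0 := by exact_mod_cast (M.mu_pos _).ne'
  have hP : ∀ z : ℝ, HasDerivAt (fun z : ℝ => ((f z).1 : ℂ))
      (((ω ^ 2 * (f z).2 : ℝ) : ℂ) / M.mu j.castSucc) z := fun z => by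
    refine (hasDerivAt_layerFlow_fst _ _ z u).ofReal_comp.congr_deriv ?_
    simp only [coefA, hf]
    push_cast
    ring
  have hQ : ∀ z : ℝ, HasDerivAt (fun z : ℝ => ((ω ^ 2 * (f z).2 : ℝ) : ℂ))
      (M.mu j.castSucc * M.nu ω k j.castSucc ^ 2 * (f z).1) z := fun z => by
    refine ((hasDerivAt_layerFlow_snd _ _ z u).const_mul (ω ^ 2)).ofReal_comp.congr_deriv ?_
    rw [nu_sq, coefB]
    norm_cast
    have := (M.C_pos j.castSucc).ne'
    simp only [hf, coefB]
    field_simp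
    ring
  have f0 : f 0 = u := by simp [hf]
  unfold transfer
  by_cases hν : M.nu ω k j.castSucc = 0
  · have h := eq_affine_of_hasDerivAt hP (fun z => by simpa [hν] using hQ z) (M.T j)
    simp only [f0] at h
    simp only [hν, if_true]
    rw [show layerFlow (M.coefA ω j.castSucc) (M.coefB (k / ω) j.castSucc) (M.T j) u = f (M.T j)
      from rfl, h.1, h.2]
    ext i
    fin_cases i <;> simp [Matrix.mulVec, dotProduct, Fin.sum_univ_two]
  · have h := eq_cosh_sinh_of_hasDerivAt hm hν hP hQ (M.T j)
    simp only [f0] at h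
    simp only [hν, if_false]
    rw [show layerFlow (M.coefA ω j.castSucc) (M.coefB (k / ω) j.castSucc) (M.T j) u = f (M.T j)
      from rfl, h.1, h.2]
    ext i
    fin_cases i <;> simp [Matrix.mulVec, dotProduct, Fin.sum_univ_two]

lemma PQ_eq {ω : ℝ} (hω : ω ≠ 0) (k : ℝ) (j : Fin (n + 1)) :
    M.PQ ω k j = ![((M.state ω (k / ω) j).1 : ℂ), ((ω ^ 2 * (M.state ω (k / ω) j).2 : ℝ) : ℂ)] := by
  induction j using Fin.induction with
  | zero => simp [PQ]
  | succ j ih =>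
    have : M.PQ ω k j.succ = (M.transfer ω k j).mulVec (M.PQ ω k j.castSucc) :=
      Fin.induction_succ ..
    rw [this, ih, M.transfer_mulVec hω, state_succ]

lemma dispersion_eq {ω : ℝ} (hω : ω ≠ 0) (k : ℝ) :
    M.dispersion ω k = M.mu (Fin.last n) * M.nu ω k (Fin.last n) *
      (M.state ω (k / ω) (Fin.last n)).1 +
      ((ω ^ 2 * (M.state ω (k / ω) (Fin.last n)).2 : ℝ) : ℂ) := by
  simp [dispersion, M.PQ_eq hω]

lemma le_div_iff_nonneg {ω k : ℝ} (hω : 0 < ω) (hk : 0 ≤ k) :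
    1 / M.Cinf ≤ k / ω ↔ 0 ≤ M.C (Fin.last n) ^ 2 * k ^ 2 - ω ^ 2 := by
  have hC := M.Cinf_pos
  rw [div_le_div_iff₀ hC hω, one_mul, sub_nonneg, ← mul_pow, mul_comm k]
  exact (pow_le_pow_iff_left₀ hω.le (mul_nonneg hC.le hk) two_ne_zero).symm

lemma nu_last_eq {ω k : ℝ} (hω : 0 < ω) (hk : 0 ≤ k) (h : 1 / M.Cinf ≤ k / ω) :
    M.nu ω k (Fin.last n) = ((ω * √((k / ω) ^ 2 - 1 / M.Cinf ^ 2) : ℝ) : ℂ) := by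
  have hC := M.Cinf_pos
  rw [nu, if_pos ((M.le_div_iff_nonneg hω hk).1 h)]
  congr 1
  have : M.C (Fin.last n) ^ 2 * k ^ 2 - ω ^ 2 =
      (M.Cinf * ω) ^ 2 * ((k / ω) ^ 2 - 1 / M.Cinf ^ 2) := by
    unfold Cinf at hC ⊢
    field_simp
  rw [this, Real.sqrt_mul (sq_nonneg _), Real.sqrt_sq (by positivity)]
  unfold Cinf at hC ⊢
  field_simp

/-- The phase, which is a multiple of `π` exactly at the solutions of the dispersion relation. -/
def phase (ω s : ℝ) : ℝ :=
  M.angle ω s - Real.arctan (M.mu (Fin.last n) * √(s ^ 2 - 1 / M.Cinf ^ 2) / ω)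

lemma state_last_eq (ω s : ℝ) :
    (M.state ω s (Fin.last n)).1 =
      Real.exp (M.logState ω s (Fin.last n)).re * Real.cos (M.angle ω s) ∧
    (M.state ω s (Fin.last n)).2 =
      -(Real.exp (M.logState ω s (Fin.last n)).re * Real.sin (M.angle ω s)) := by
  have h := M.exp_logState ω s (Fin.last n)
  have h1 := congrArg Complex.re h
  have h2 := congrArg Complex.im h
  rw [Complex.exp_re] at h1
  rw [Complex.exp_im] at h2
  simp only [toComplex] at h1 h2
  exact ⟨h1.symm, by unfold angle; linarith⟩

lemma dispersion_of_le {ω k : ℝ} (hω : 0 < ω) (hk : 0 ≤ k) (h : 1 / M.Cinf ≤ k / ω) :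
    M.dispersion ω k = ((ω * (M.mu (Fin.last n) * √((k / ω) ^ 2 - 1 / M.Cinf ^ 2) *
      (M.state ω (k / ω) (Fin.last n)).1 + ω * (M.state ω (k / ω) (Fin.last n)).2) : ℝ) : ℂ) := by
  rw [M.dispersion_eq hω.ne', M.nu_last_eq hω hk h]
  push_cast
  ring

/-- For s ≥ 1/C_∞, inserting P = r cos θ and p = -r sin θ turns the relation into the vanishing of
the sine of the phase. For s < 1/C_∞, ν_∞ is purely imaginary and nonzero while P and Q are real, so
both would have to vanish. -/
lemma dispersion_eq_zero_iff {ω k : ℝ} (hω : 0 < ω) (hk : 0 ≤ k) :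
    M.dispersion ω k = 0 ↔ 1 / M.Cinf ≤ k / ω ∧ ∃ m : ℤ, M.phase ω (k / ω) = m * Real.pi := by
  by_cases h : 1 / M.Cinf ≤ k / ω
  · rw [M.dispersion_of_le hω hk h]
    simp only [h, true_and]
    set K := M.mu (Fin.last n) * √((k / ω) ^ 2 - 1 / M.Cinf ^ 2) with hK
    set r := Real.exp (M.logState ω (k / ω) (Fin.last n)).re
    have hr : 0 < r := Real.exp_pos _
    have hc := Real.cos_arctan_pos (K / ω)
    have ht : Real.sin (Real.arctan (K / ω)) = K / ω * Real.cos (Real.arctan (K / ω)) := by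
      rw [← Real.tan_mul_cos hc.ne', Real.tan_arctan]
    obtain ⟨h1, h2⟩ := M.state_last_eq ω (k / ω)
    have e : ω * (K * (M.state ω (k / ω) (Fin.last n)).1 +
        ω * (M.state ω (k / ω) (Fin.last n)).2) * Real.cos (Real.arctan (K / ω)) =
        -(r * ω ^ 2) * Real.sin (M.phase ω (k / ω)) := by
      rw [phase, Real.sin_sub, ← hK, ht, h1, h2]
      field_simp
      ring
    have e2 : (∃ m : ℤ, M.phase ω (k / ω) = m * Real.pi) ↔
        Real.sin (M.phase ω (k / ω)) = 0 := by
      rw [Real.sin_eq_zero_iff]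
      exact exists_congr fun _ => eq_comm
    rw [e2, Complex.ofReal_eq_zero, ← mul_left_inj' hc.ne', zero_mul, e, mul_eq_zero,
      or_iff_right (by have := mul_pos hr (pow_pos hω 2); linarith)]
  · simp only [h, false_and, iff_false]
    intro h0
    rw [M.le_div_iff_nonneg hω hk] at h
    rw [M.dispersion_eq hω.ne', nu, if_neg h] at h0
    have hre := congrArg Complex.re h0
    have him := congrArg Complex.im h0
    have hs : 0 < √(ω ^ 2 - M.C (Fin.last n) ^ 2 * k ^ 2) := Real.sqrt_pos.2 (by linarith)
    simp [-Complex.ofReal_inv, -Complex.ofReal_pow, hω.ne'] at hre him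
    have hC := (M.C_pos (Fin.last n)).ne'
    have hm := (M.mu_pos (Fin.last n)).ne'
    refine M.state_ne_zero ω (k / ω) (Fin.last n) (Prod.ext ?_ hre)
    simpa [hm, hC, hs.ne'] using him

lemma sqrt_slowness_strictMonoOn :
    StrictMonoOn (fun s : ℝ => √(s ^ 2 - 1 / M.Cinf ^ 2)) (Ici (1 / M.Cinf)) := by
  intro s hs t _ hst
  have h0 : 0 < 1 / M.Cinf := one_div_pos.2 M.Cinf_pos
  have hs0 : 0 < s := h0.trans_le hs
  refine Real.sqrt_lt_sqrt ?_ ?_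
  · rw [← one_div_pow]
    exact sub_nonneg.2 (pow_le_pow_left₀ h0.le hs 2)
  · exact sub_lt_sub_right (pow_lt_pow_left₀ hst hs0.le two_ne_zero) _

lemma slowness_sq_pos {s : ℝ} (hs : 1 / M.Cinf < s) : 0 < s ^ 2 - 1 / M.Cinf ^ 2 := by
  rw [← one_div_pow]
  exact sub_pos.2 (pow_lt_pow_left₀ hs (one_div_pos.2 M.Cinf_pos).le two_ne_zero)

lemma phase_strictAntiOn (hn : 1 ≤ n) {ω : ℝ} (hω : 0 < ω) :
    StrictAntiOn (M.phase ω) (Ici (1 / M.Cinf)) := by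
  intro s hs t ht hst
  have h0 : 0 < 1 / M.Cinf := one_div_pos.2 M.Cinf_pos
  have h1 := M.angle_strictAntiOn hn ω (h0.le.trans hs) (h0.le.trans ht) hst
  have h2 := M.sqrt_slowness_strictMonoOn hs ht hst
  have hm := M.mu_pos (Fin.last n)
  have h3 : M.mu (Fin.last n) * √(s ^ 2 - 1 / M.Cinf ^ 2) / ω ≤
      M.mu (Fin.last n) * √(t ^ 2 - 1 / M.Cinf ^ 2) / ω :=
    div_le_div_of_nonneg_right (mul_le_mul_of_nonneg_left h2.le hm.le) hω.le
  have h4 := Real.arctan_strictMono.monotone h3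
  simp only [phase]
  linarith

/-- This weak form also covers s = 1/C_∞, where the arctangent term is zero and gives no strictness.
-/
lemma phase_monotoneOn (s : ℝ) : MonotoneOn (fun ω => M.phase ω s) (Ioi 0) := by
  intro ω hω ω' hω' h
  have h1 := M.angle_monotoneOn s (le_of_lt (mem_Ioi.1 hω)) (le_of_lt (mem_Ioi.1 hω')) h
  have hm := M.mu_pos (Fin.last n)
  have h2 : M.mu (Fin.last n) * √(s ^ 2 - 1 / M.Cinf ^ 2) / ω' ≤
      M.mu (Fin.last n) * √(s ^ 2 - 1 / M.Cinf ^ 2) / ω :=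
    div_le_div_of_nonneg_left (by positivity) hω h
  have h3 := Real.arctan_strictMono.monotone h2
  simp only [phase] at h1 ⊢
  linarith

lemma phase_strictMonoOn {s : ℝ} (hs : 1 / M.Cinf < s) :
    StrictMonoOn (fun ω => M.phase ω s) (Ioi 0) := by
  intro ω hω ω' hω' h
  have h1 := M.angle_monotoneOn s (le_of_lt (mem_Ioi.1 hω)) (le_of_lt (mem_Ioi.1 hω')) h.le
  have hm := M.mu_pos (Fin.last n)
  have hq := Real.sqrt_pos.2 (M.slowness_sq_pos hs)
  have h2 : M.mu (Fin.last n) * √(s ^ 2 - 1 / M.Cinf ^ 2) / ω' <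
      M.mu (Fin.last n) * √(s ^ 2 - 1 / M.Cinf ^ 2) / ω :=
    div_lt_div_of_pos_left (by positivity) hω h
  have h3 := Real.arctan_strictMono h2
  simp only [phase] at h1 ⊢
  linarith

lemma continuousOn_phase_left (s : ℝ) : ContinuousOn (fun ω => M.phase ω s) (Ioi 0) := by
  refine (M.continuous_angle.comp (continuous_id.prodMk continuous_const)).continuousOn.sub
    (Real.continuous_arctan.comp_continuousOn (continuousOn_const.div continuousOn_id ?_))
  exact fun ω hω => (mem_Ioi.1 hω).ne'

lemma continuous_phase_right (ω : ℝ) : Continuous (M.phase ω) := by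
  refine (M.continuous_angle.comp (continuous_const.prodMk continuous_id)).sub
    (Real.continuous_arctan.comp ?_)
  fun_prop

lemma phase_Czero_neg (hC : M.Czero < M.Cinf) {ω : ℝ} (hω : 0 < ω) :
    M.phase ω (1 / M.Czero) < 0 := by
  have h1 := M.angle_nonpos le_rfl ω
  have h2 : 1 / M.Cinf < 1 / M.Czero := one_div_lt_one_div_of_lt M.Czero_pos hC
  have hq := Real.sqrt_pos.2 (M.slowness_sq_pos h2)
  have hm := M.mu_pos (Fin.last n)
  have h3 := Real.arctan_pos.2 (show 0 < M.mu (Fin.last n) *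
    √((1 / M.Czero) ^ 2 - 1 / M.Cinf ^ 2) / ω by positivity)
  unfold phase
  linarith

/-- The angle exceeds -π/2 and the arctangent is below π/2. Only nonnegative multiples of π can
therefore occur. -/
lemma neg_pi_lt_phase {ω : ℝ} (hω : 0 < ω) (s : ℝ) : -Real.pi < M.phase ω s := by
  have h1 := M.neg_pi_div_two_lt_angle hω.le s
  have h2 := Real.arctan_lt_pi_div_two (M.mu (Fin.last n) * √(s ^ 2 - 1 / M.Cinf ^ 2) / ω)
  unfold phase
  linarith

/-- As ω decreases to 0 the arctangent tends to π/2, while the angle tends to a value below π/2. -/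
lemma exists_phase_neg {s : ℝ} (hs : 1 / M.Cinf < s) : ∃ ω, 0 < ω ∧ M.phase ω s < 0 := by
  have hq := Real.sqrt_pos.2 (M.slowness_sq_pos hs)
  have hm := M.mu_pos (Fin.last n)
  have h1 : Tendsto (fun ω : ℝ => M.mu (Fin.last n) * √(s ^ 2 - 1 / M.Cinf ^ 2) / ω)
      (𝓝[>] 0) atTop := by
    simp only [div_eq_mul_inv _ (_ : ℝ)]
    exact tendsto_inv_nhdsGT_zero.const_mul_atTop (by positivity)
  have h2 : Tendsto (fun ω => M.phase ω s) (𝓝[>] 0) (𝓝 (M.angle 0 s - Real.pi / 2)) := by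
    refine Tendsto.sub ?_ ((Real.tendsto_arctan_atTop.mono_right nhdsWithin_le_nhds).comp h1)
    exact ((M.continuous_angle.comp (continuous_id.prodMk continuous_const)).tendsto
      (0 : ℝ)).mono_left nhdsWithin_le_nhds
  have h3 := (abs_lt.1 (M.abs_angle_zero_left_lt s)).2
  have h4 := (h2.eventually_lt_const (by linarith : _ < (0 : ℝ))).and self_mem_nhdsWithin
  obtain ⟨ω, h5, h6⟩ := h4.exists
  exact ⟨ω, h6, h5⟩

lemma exists_le_phase (hC : M.Czero < M.Cinf) {s : ℝ} (hs0 : 0 ≤ s) (hs : s < 1 / M.Czero)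
    (N : ℝ) : ∃ ω, 0 < ω ∧ N ≤ M.phase ω s := by
  obtain ⟨ω, h1, h2⟩ := M.exists_le_angle hC hs0 hs (N + Real.pi / 2)
  refine ⟨ω, h1, ?_⟩
  have h3 := Real.arctan_lt_pi_div_two (M.mu (Fin.last n) * √(s ^ 2 - 1 / M.Cinf ^ 2) / ω)
  unfold phase
  linarith

lemma analyticAt_phase {ω s : ℝ} (hω : ω ≠ 0) (hs : 1 / M.Cinf < s) :
    AnalyticAt ℝ (fun q : ℝ × ℝ => M.phase q.1 q.2) (ω, s) := by
  -- The exponent `⊤` means analytic; s > 1/C_∞ keeps the square root away from its singularity.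
  have h0 : ContDiffAt ℝ ⊤ (fun q : ℝ × ℝ => q.2 ^ 2 - 1 / M.Cinf ^ 2) (ω, s) :=
    (contDiffAt_snd.pow 2).sub contDiffAt_const
  have h1 : ContDiffAt ℝ ⊤ (fun q : ℝ × ℝ => M.mu (Fin.last n) *
      √(q.2 ^ 2 - 1 / M.Cinf ^ 2) / q.1) (ω, s) :=
    (contDiffAt_const.mul (h0.sqrt (M.slowness_sq_pos hs).ne')).div contDiffAt_fst hω
  have h2 := (Real.contDiff_arctan (n := ⊤)).contDiffAt.comp (ω, s) h1
  exact (M.analyticAt_angle (ω, s)).sub h2.analyticAt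

lemma exists_hasDerivAt_phase_neg (hn : 1 ≤ n) {ω s : ℝ} (hω : 0 < ω) (hs : 1 / M.Cinf < s) :
    ∃ d < 0, HasDerivAt (M.phase ω) d s := by
  have hs0 : 0 < s := (one_div_pos.2 M.Cinf_pos).trans hs
  obtain ⟨d, hd, h⟩ := M.exists_hasDerivAt_angle_neg hn ω hs0
  have hp := M.slowness_sq_pos hs
  have h2 := (((((hasDerivAt_pow 2 s).sub_const (1 / M.Cinf ^ 2)).sqrt hp.ne').const_mul
    (M.mu (Fin.last n))).div_const ω).arctan
  refine ⟨_, ?_, h.sub h2⟩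
  have hm := M.mu_pos (Fin.last n)
  have hq := Real.sqrt_pos.2 hp
  refine (sub_le_self _ ?_).trans_lt hd
  positivity

end LayeredMedium

/-! ### Love modes and the dispersion relation -/

lemma layerFlow_smul (A B z c : ℝ) (u : ℝ × ℝ) :
    layerFlow A B z (c • u) = c • layerFlow A B z u := by
  simp [layerFlow]

/-- Uniqueness for the system `P' = A p`, `p' = -B P` on an interval. -/
lemma eq_layerFlow_of_hasDerivAt {A B a b : ℝ} {P p : ℝ → ℝ} (hab : a ≤ b)
    (cP : ContinuousOn P (Icc a b)) (cp : ContinuousOn p (Icc a b))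
    (hP : ∀ z ∈ Ioo a b, HasDerivAt P (A * p z) z)
    (hp : ∀ z ∈ Ioo a b, HasDerivAt p (-(B * P z)) z) :
    (P b, p b) = layerFlow A B (b - a) (P a, p a) := by
  rcases hab.eq_or_lt with rfl | hlt
  · simp
  -- The difference of the two solutions has constant Wronskian with the solution equal to e at b.
  -- It vanishes at a, and e is arbitrary.
  have key : ∀ e : ℝ × ℝ, p b * e.1 - P b * e.2 =
      (layerFlow A B (b - a) (P a, p a)).2 * e.1 - (layerFlow A B (b - a) (P a, p a)).1 * e.2 := by
    intro e
    set u := fun z => layerFlow A B (z - a) (P a, p a) with hu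
    set v := fun z => layerFlow A B (z - b) e with hv
    have cu : Continuous u := (continuous_layerFlow A B _).comp (continuous_sub_right a)
    have cv : Continuous v := (continuous_layerFlow A B _).comp (continuous_sub_right b)
    have du1 : ∀ z, HasDerivAt (fun z => (u z).1) (A * (u z).2) z := fun z => by
      simpa [hu] using (hasDerivAt_layerFlow_fst A B (z - a) (P a, p a)).comp_sub_const z a
    have du2 : ∀ z, HasDerivAt (fun z => (u z).2) (-(B * (u z).1)) z := fun z => by
      simpa [hu] using (hasDerivAt_layerFlow_snd A B (z - a) (P a, p a)).comp_sub_const z a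
    have dv1 : ∀ z, HasDerivAt (fun z => (v z).1) (A * (v z).2) z := fun z => by
      simpa [hv] using (hasDerivAt_layerFlow_fst A B (z - b) e).comp_sub_const z b
    have dv2 : ∀ z, HasDerivAt (fun z => (v z).2) (-(B * (v z).1)) z := fun z => by
      simpa [hv] using (hasDerivAt_layerFlow_snd A B (z - b) e).comp_sub_const z b
    have hd : ∀ z ∈ Ioo a b, HasDerivAt (fun z => (p z - (u z).2) * (v z).1 -
        (P z - (u z).1) * (v z).2) 0 z := fun z hz => by
      refine ((((hp z hz).sub (du2 z)).mul (dv1 z)).sub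
        (((hP z hz).sub (du1 z)).mul (dv2 z))).congr_deriv ?_
      simp only [Pi.sub_apply]
      ring
    obtain ⟨c, hc, hc'⟩ := exists_hasDerivAt_eq_slope _ (fun _ => (0 : ℝ)) hlt
      (((cp.sub cu.snd.continuousOn).mul cv.fst.continuousOn).sub
        ((cP.sub cu.fst.continuousOn).mul cv.snd.continuousOn)) hd
    rw [eq_comm, div_eq_zero_iff, or_iff_left (sub_pos.2 hlt).ne'] at hc'
    simp [hu, hv] at hc'
    linarith
  have h1 := key (1, 0)
  have h2 := key (0, 1)
  simp at h1 h2
  exact Prod.ext h2 h1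

/-- The solution of `P' = A p`, `p' = -B P` in terms of exponentials, in the evanescent case. -/
lemma layerFlow_fst_eq_exp {A B l : ℝ} (hl : l ^ 2 = -(A * B)) (hl0 : l ≠ 0) (u : ℝ × ℝ) (z : ℝ) :
    (layerFlow A B z u).1 = ((A * u.2 + l * u.1) * Real.exp (l * z) -
      (A * u.2 - l * u.1) * Real.exp (-(l * z))) / (2 * l) := by
  have d1 := fun z => hasDerivAt_layerFlow_fst A B z u
  have d2 := fun z => hasDerivAt_layerFlow_snd A B z u
  have he : ∀ c z : ℝ, HasDerivAt (fun z => Real.exp (c * z)) (Real.exp (c * z) * c) z :=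
    fun c z => by simpa using ((hasDerivAt_id z).const_mul c).exp
  -- For c = ±l the combination A p + c P satisfies y' = c y.
  have key : ∀ c : ℝ, c ^ 2 = -(A * B) → A * (layerFlow A B z u).2 + c * (layerFlow A B z u).1 =
      (A * u.2 + c * u.1) * Real.exp (c * z) := by
    intro c hc
    have hd : ∀ z, HasDerivAt (fun z => (A * (layerFlow A B z u).2 + c * (layerFlow A B z u).1) *
        Real.exp (-c * z)) 0 z := fun z => by
      refine ((((d2 z).const_mul A).add ((d1 z).const_mul c)).mul (he (-c) z)).congr_deriv ?_
      simp only [Pi.add_apply]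
      linear_combination (-(layerFlow A B z u).1 * Real.exp (-c * z)) * hc
    have h := is_const_of_deriv_eq_zero (fun z => (hd z).differentiableAt)
      (fun z => (hd z).deriv) z 0
    simp only [layerFlow_zero, mul_zero, Real.exp_zero, mul_one] at h
    rw [← h, mul_assoc, ← Real.exp_add]
    simp
  have h1 := key l hl
  have h2 := key (-l) (by rw [neg_sq, hl])
  rw [eq_div_iff (by simpa using hl0), ← h1]
  rw [neg_mul, neg_mul, neg_mul, ← sub_eq_add_neg, ← sub_eq_add_neg] at h2
  rw [← h2]
  ring

namespace LayeredMedium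

variable {n : ℕ} (M : LayeredMedium n)

lemma layerAt_eq {z : ℝ} {j : Fin (n + 1)} (h1 : M.H j ≤ z) (h2 : ∀ i, j < i → z < M.H i) :
    M.layerAt z = j := by
  refine le_antisymm (Finset.sup_le fun i hi => ?_) ?_
  · by_contra! hlt
    exact absurd (Finset.mem_filter.1 hi).2 (not_le.2 (h2 i hlt))
  · exact Finset.le_sup (f := id) (by simpa using h1)

lemma exists_layer {z : ℝ} (hz : 0 ≤ z) :
    ∃ j, M.H j ≤ z ∧ ∀ i, j < i → z < M.H i := by
  have hne : (Finset.univ.filter fun j => M.H j ≤ z).Nonempty := ⟨0, by simpa [M.H_zero] using hz⟩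
  refine ⟨_, (Finset.mem_filter.1 (Finset.max'_mem _ hne)).2, fun i hi => ?_⟩
  by_contra! hle
  exact absurd (Finset.le_max' _ i (by simpa using hle)) (not_le.2 hi)

lemma H_nonneg (j : Fin (n + 1)) : 0 ≤ M.H j := M.H_zero ▸ M.H_strictMono.monotone (Fin.zero_le j)

/-- The decay rate `ν_∞` of a mode in the last layer. -/
def decay (ω s : ℝ) : ℝ := ω * √(s ^ 2 - 1 / M.Cinf ^ 2)

lemma decay_pos {ω s : ℝ} (hω : 0 < ω) (hs : 1 / M.Cinf < s) : 0 < M.decay ω s :=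
  mul_pos hω (Real.sqrt_pos.2 (M.slowness_sq_pos hs))

lemma decay_sq {ω s : ℝ} (hs : 1 / M.Cinf < s) :
    M.decay ω s ^ 2 = -(M.coefA ω (Fin.last n) * M.coefB s (Fin.last n)) := by
  have := (M.mu_pos (Fin.last n)).ne'
  rw [decay, mul_pow, Real.sq_sqrt (M.slowness_sq_pos hs).le, coefA, coefB, Cinf]
  field_simp
  ring

/-- The right-hand side is the coefficient of the growing exponential in the last layer, up to a
nonzero factor. -/
lemma dispersion_eq_zero_iff_decay {ω k : ℝ} (hω : 0 < ω) (hs : 1 / M.Cinf < k / ω) :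
    M.dispersion ω k = 0 ↔ M.coefA ω (Fin.last n) * (M.state ω (k / ω) (Fin.last n)).2 +
      M.decay ω (k / ω) * (M.state ω (k / ω) (Fin.last n)).1 = 0 := by
  have hk : 0 ≤ k := by
    have := (one_div_pos.2 M.Cinf_pos).trans hs
    exact ((div_pos_iff_of_pos_right hω).1 this).le
  have hm := (M.mu_pos (Fin.last n)).ne'
  rw [M.dispersion_of_le hω hk hs.le, Complex.ofReal_eq_zero, coefA, decay,
    ← mul_right_inj' hm (b := _ + _), mul_zero]
  refine Eq.congr ?_ rfl
  field_simp
  ring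

lemma eq_layerFlow_of_isLoveMode {ω k : ℝ} (hω : 0 < ω) {φ σ : ℝ → ℝ}
    (cφ : ContinuousOn φ (Ici 0)) (cσ : ContinuousOn σ (Ici 0))
    (heq : ∀ z, 0 ≤ z → (∀ j, j ≠ 0 → z ≠ M.H j) →
      (∃ d, HasDerivWithinAt φ d (Ici 0) z ∧ σ z = M.muAt z * d) ∧
      HasDerivWithinAt σ
        (-(M.muAt z * ω ^ 2 * (1 / M.CAt z ^ 2 - k ^ 2 / ω ^ 2) * φ z)) (Ici 0) z)
    {j : Fin (n + 1)} {z : ℝ} (h1 : M.H j ≤ z) (h2 : ∀ i, j < i → z ≤ M.H i) :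
    (φ z, σ z / ω ^ 2) = layerFlow (M.coefA ω j) (M.coefB (k / ω) j) (z - M.H j)
      (φ (M.H j), σ (M.H j) / ω ^ 2) := by
  have hH := M.H_nonneg j
  have hsub : Icc (M.H j) z ⊆ Ici 0 := fun y hy => hH.trans hy.1
  have hy : ∀ y ∈ Ioo (M.H j) z, HasDerivAt φ (σ y / M.mu j) y ∧
      HasDerivAt σ (-(M.mu j * ω ^ 2 * (1 / M.C j ^ 2 - k ^ 2 / ω ^ 2) * φ y)) y := by
    intro y hy
    have hy0 : 0 < y := hH.trans_lt hy.1
    have hl : M.layerAt y = j := M.layerAt_eq hy.1.le fun i hi => hy.2.trans_le (h2 i hi)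
    obtain ⟨⟨d, hd, hσ⟩, hd2⟩ := heq y hy0.le fun i _ hi => by
      rcases le_or_gt i j with h | h
      · exact absurd (M.H_strictMono.monotone h) (not_le.2 (hi ▸ hy.1))
      · exact absurd (h2 i h) (not_le.2 (hi ▸ hy.2))
    rw [muAt, hl] at hσ
    rw [muAt, CAt, hl] at hd2
    have hm := (M.mu_pos j).ne'
    refine ⟨?_, hd2.hasDerivAt (Ici_mem_nhds hy0)⟩
    rw [hσ, mul_div_cancel_left₀ _ hm]
    exact hd.hasDerivAt (Ici_mem_nhds hy0)
  refine eq_layerFlow_of_hasDerivAt (P := φ) (p := fun z => σ z / ω ^ 2) h1 (cφ.mono hsub)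
    ((cσ.mono hsub).div_const _) (fun y h => (hy y h).1.congr_deriv ?_)
    fun y h => ((hy y h).2.div_const _).congr_deriv ?_
  · rw [coefA]
    field_simp
  · rw [coefB, div_pow]
    field_simp

/-- By uniqueness a mode is φ(0) times the shot solution, and its limit at infinity excludes the
growing exponential. -/
lemma dispersion_eq_zero_of_isLoveMode {ω k : ℝ} (hω : 0 < ω) {φ : ℝ → ℝ}
    (h : M.IsLoveMode ω k φ) : M.dispersion ω k = 0 := by
  obtain ⟨σ, cσ, heq⟩ := h.equation
  have hs := h.wavenumber
  have flow := fun {j : Fin (n + 1)} {z : ℝ} => M.eq_layerFlow_of_isLoveMode (j := j) (z := z)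
    hω h.continuousOn cσ heq
  have hσ0 : σ 0 = 0 := by
    obtain ⟨⟨d, hd, hσ⟩, -⟩ := heq 0 le_rfl fun j hj h0 =>
      hj (M.H_strictMono.injective (h0.symm.trans M.H_zero.symm))
    have hd0 : d = 0 := (uniqueDiffOn_Ici (0 : ℝ) 0 (mem_Ici.2 le_rfl)).eq_deriv _ hd h.surface
    rw [hσ, hd0, mul_zero]
  have hstate : ∀ j, (φ (M.H j), σ (M.H j) / ω ^ 2) = φ 0 • M.state ω (k / ω) j := fun j => by
    induction j using Fin.induction with
    | zero => simp [M.H_zero, hσ0]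
    | succ j ih =>
      rw [flow (j := j.castSucc) (M.H_strictMono j.castSucc_lt_succ).le
        (fun i hi => M.H_strictMono.monotone (Fin.castSucc_lt_iff_succ_le.1 hi)), ih,
        layerFlow_smul, state_succ]
      rfl
  have hφ0 : φ 0 ≠ 0 := fun h0 => by
    obtain ⟨z, hz, hne⟩ := h.nonzero
    obtain ⟨j, hj1, hj2⟩ := M.exists_layer hz
    have := flow hj1 fun i hi => (hj2 i hi).le
    rw [hstate, h0, layerFlow_smul, zero_smul] at this
    exact hne (congrArg Prod.fst this)
  rw [M.dispersion_eq_zero_iff_decay hω hs]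
  set l := M.decay ω (k / ω)
  have hl : 0 < l := M.decay_pos hω hs
  set u := M.state ω (k / ω) (Fin.last n)
  set A := M.coefA ω (Fin.last n)
  have hφ : ∀ z, M.H (Fin.last n) ≤ z → φ z = φ 0 *
      (((A * u.2 + l * u.1) * Real.exp (l * (z - M.H (Fin.last n))) -
      (A * u.2 - l * u.1) * Real.exp (-(l * (z - M.H (Fin.last n))))) / (2 * l)) := fun z hz => by
    have := flow hz fun i hi => absurd hi (not_lt.2 (Fin.le_last i))
    rw [hstate, layerFlow_smul] at this
    have := congrArg Prod.fst this
    rwa [Prod.smul_fst, layerFlow_fst_eq_exp (M.decay_sq hs) hl.ne'] at this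
  have t1 : Tendsto (fun z : ℝ => l * (z - M.H (Fin.last n))) atTop atTop :=
    (tendsto_atTop_add_const_right _ _ tendsto_id).const_mul_atTop hl
  have t2 : Tendsto (fun z : ℝ => Real.exp (-(l * (z - M.H (Fin.last n))))) atTop (𝓝 0) :=
    Real.tendsto_exp_neg_atTop_nhds_zero.comp t1
  -- Below the last interface this expression equals the growing coefficient, yet it tends to 0.
  have t3 : Tendsto (fun z : ℝ => (φ z / φ 0 * (2 * l) + (A * u.2 - l * u.1) *
      Real.exp (-(l * (z - M.H (Fin.last n))))) * Real.exp (-(l * (z - M.H (Fin.last n)))))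
      atTop (𝓝 ((0 / φ 0 * (2 * l) + (A * u.2 - l * u.1) * 0) * 0)) :=
    (((h.tendsto.div_const _).mul_const _).add (t2.const_mul _)).mul t2
  rw [mul_zero] at t3
  refine tendsto_nhds_unique (tendsto_const_nhds.congr' ?_) t3
  filter_upwards [eventually_ge_atTop (M.H (Fin.last n))] with z hz
  rw [hφ z hz, Real.exp_neg]
  field_simp
  ring

/-- The state at the top of each layer, the medium being cut at depth `z`. -/
def cutState (ω s z : ℝ) : Fin (n + 1) → ℝ × ℝ :=
  Fin.induction (motive := fun _ => ℝ × ℝ) (1, 0)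
    (fun j u => layerFlow (M.coefA ω j.castSucc) (M.coefB s j.castSucc)
      (max 0 (min (z - M.H j.castSucc) (M.T j))) u)

lemma cutState_succ (ω s z : ℝ) (j : Fin n) : M.cutState ω s z j.succ =
    layerFlow (M.coefA ω j.castSucc) (M.coefB s j.castSucc)
      (max 0 (min (z - M.H j.castSucc) (M.T j))) (M.cutState ω s z j.castSucc) :=
  Fin.induction_succ ..

@[simp] lemma cutState_zero (ω s z : ℝ) : M.cutState ω s z 0 = (1, 0) := rfl

attribute [irreducible] cutState

/-- The solution `(P, p)` at depth `z`. -/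
def depthState (ω s z : ℝ) : ℝ × ℝ :=
  layerFlow (M.coefA ω (Fin.last n)) (M.coefB s (Fin.last n)) (max 0 (z - M.H (Fin.last n)))
    (M.cutState ω s z (Fin.last n))

/-- The clamped thicknesses are continuous in z, so no matching at the interfaces is needed. -/
lemma continuous_depthState (ω s : ℝ) : Continuous (M.depthState ω s) := by
  have : ∀ j, Continuous fun z => M.cutState ω s z j := fun j => by
    induction j using Fin.induction with
    | zero => simpa only [cutState_zero] using continuous_const
    | succ j ih =>
      simp only [cutState_succ]
      exact continuous_const.layer_flow continuous_const (by fun_prop) ih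
  exact continuous_const.layer_flow continuous_const (by fun_prop) (this _)

lemma cutState_of_le (ω s : ℝ) {z : ℝ} {j : Fin (n + 1)} (h : M.H j ≤ z) :
    M.cutState ω s z j = M.state ω s j := by
  induction j using Fin.induction with
  | zero => simp
  | succ j ih =>
    have h1 := M.T_pos j
    have h2 : M.T j ≤ z - M.H j.castSucc := by unfold T; linarith
    rw [cutState_succ, state_succ, min_eq_right h2, max_eq_right h1.le,
      ih ((M.H_strictMono j.castSucc_lt_succ).le.trans h)]

lemma cutState_of_lt (ω s : ℝ) {z : ℝ} {j : Fin (n + 1)} (h1 : M.H j ≤ z)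
    (h2 : ∀ i, j < i → z < M.H i) (i : Fin (n + 1)) (hi : j < i) :
    M.cutState ω s z i =
      layerFlow (M.coefA ω j) (M.coefB s j) (z - M.H j) (M.state ω s j) := by
  induction i using Fin.induction with
  | zero => exact absurd hi (not_lt.2 (Fin.zero_le j))
  | succ i ih =>
    rw [cutState_succ]
    rcases (Fin.le_castSucc_iff.2 hi).eq_or_lt with h | h
    · have h3 : z - M.H i.castSucc ≤ M.T i := by
        have := h2 _ hi
        unfold T
        linarith
      subst h
      rw [min_eq_left h3, max_eq_right (sub_nonneg.2 h1), M.cutState_of_le ω s h1]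
    · have h3 := M.T_pos i
      have h4 : z - M.H i.castSucc ≤ 0 := sub_nonpos.2 (h2 _ h).le
      rw [max_eq_left ((min_le_left _ _).trans h4), layerFlow_zero, ih h]

lemma depthState_eq (ω s : ℝ) {z : ℝ} {j : Fin (n + 1)} (h1 : M.H j ≤ z)
    (h2 : ∀ i, j < i → z < M.H i) : M.depthState ω s z =
      layerFlow (M.coefA ω j) (M.coefB s j) (z - M.H j) (M.state ω s j) := by
  rw [depthState]
  rcases (Fin.le_last j).eq_or_lt with rfl | h
  · rw [max_eq_right (sub_nonneg.2 h1), M.cutState_of_le ω s h1]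
  · rw [max_eq_left (sub_nonpos.2 (h2 _ h).le), layerFlow_zero, M.cutState_of_lt ω s h1 h2 _ h]

lemma hasDerivWithinAt_depthState (ω s : ℝ) {z : ℝ} {j : Fin (n + 1)} (hz : ∀ i, i ≠ 0 → z ≠ M.H i)
    (h1 : M.H j ≤ z) (h2 : ∀ i, j < i → z < M.H i) :
    HasDerivWithinAt (fun z => (M.depthState ω s z).1) (M.coefA ω j * (M.depthState ω s z).2)
      (Ici 0) z ∧
    HasDerivWithinAt (fun z => (M.depthState ω s z).2) (-(M.coefB s j * (M.depthState ω s z).1))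
      (Ici 0) z := by
  have ev : ∀ᶠ y in 𝓝[Ici 0] z, M.depthState ω s y =
      layerFlow (M.coefA ω j) (M.coefB s j) (y - M.H j) (M.state ω s j) := by
    -- Interior interfaces are excluded, so z can be the top of its layer only at the surface, where
    -- the neighbourhood is one-sided.
    have e1 : ∀ᶠ y in 𝓝[Ici 0] z, M.H j ≤ y := by
      rcases h1.eq_or_lt with h | h
      · have hj : j = 0 := by
          by_contra hj
          exact hz j hj h.symm
        rw [hj, M.H_zero]
        exact self_mem_nhdsWithin
      · exact mem_nhdsWithin_of_mem_nhds (Ici_mem_nhds h)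
    have e2 : ∀ᶠ y in 𝓝[Ici 0] z, ∀ i, j < i → y < M.H i := by
      refine eventually_all.2 fun i => ?_
      by_cases hi : j < i
      · filter_upwards [mem_nhdsWithin_of_mem_nhds (Iio_mem_nhds (h2 i hi))] with y hy _ using hy
      · exact Eventually.of_forall fun _ h => absurd h hi
    filter_upwards [e1, e2] with y hy1 hy2 using M.depthState_eq ω s hy1 hy2
  have hzz := M.depthState_eq ω s h1 h2
  rw [hzz]
  constructor
  · refine HasDerivWithinAt.congr_of_eventuallyEq
      (((hasDerivAt_layerFlow_fst _ _ _ _).comp_sub_const z (M.H j)).hasDerivWithinAt)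
      (ev.mono fun y hy => ?_) ?_
    · simp only [hy]
    · rw [hzz]
  · refine HasDerivWithinAt.congr_of_eventuallyEq
      (((hasDerivAt_layerFlow_snd _ _ _ _).comp_sub_const z (M.H j)).hasDerivWithinAt)
      (ev.mono fun y hy => ?_) ?_
    · simp only [hy]
    · rw [hzz]

lemma isLoveMode_depthState {ω k : ℝ} (hω : 0 < ω) (hs : 1 / M.Cinf < k / ω)
    (h0 : M.dispersion ω k = 0) :
    M.IsLoveMode ω k fun z => (M.depthState ω (k / ω) z).1 := by
  have hz0 : ∀ i : Fin (n + 1), i ≠ 0 → (0 : ℝ) ≠ M.H i := fun i hi h =>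
    hi (M.H_strictMono.injective (h.symm.trans M.H_zero.symm))
  have hl0 : M.H 0 ≤ 0 ∧ ∀ i, 0 < i → 0 < M.H i :=
    ⟨M.H_zero.le, fun i hi => M.H_zero ▸ M.H_strictMono hi⟩
  have hd0 : M.depthState ω (k / ω) 0 = (1, 0) := by
    rw [M.depthState_eq ω (k / ω) hl0.1 hl0.2]
    simp [M.H_zero]
  have c := M.continuous_depthState ω (k / ω)
  have hl := M.decay_pos hω hs
  rw [M.dispersion_eq_zero_iff_decay hω hs] at h0
  -- Without the growing part, P is a pure decaying exponential in the last layer; this gives both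
  -- square integrability and the limit.
  obtain ⟨K, hK⟩ : ∃ K : ℝ, ∀ z, M.H (Fin.last n) ≤ z →
      (M.depthState ω (k / ω) z).1 = K * Real.exp (-M.decay ω (k / ω) * z) := by
    set l := M.decay ω (k / ω)
    refine ⟨-((M.coefA ω (Fin.last n) * (M.state ω (k / ω) (Fin.last n)).2 -
      l * (M.state ω (k / ω) (Fin.last n)).1) * Real.exp (l * M.H (Fin.last n))) /
      (2 * l), fun z hz => ?_⟩
    rw [M.depthState_eq ω (k / ω) hz fun i hi => absurd hi (not_lt.2 (Fin.le_last i)),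
      layerFlow_fst_eq_exp (M.decay_sq hs) hl.ne', h0,
      show -(l * (z - M.H (Fin.last n))) = l * M.H (Fin.last n) + -l * z by ring, Real.exp_add]
    ring
  have te : Tendsto (fun z => Real.exp (-M.decay ω (k / ω) * z)) atTop (𝓝 0) := by
    refine (Real.tendsto_exp_neg_atTop_nhds_zero.comp (tendsto_id.const_mul_atTop hl)).congr ?_
    simp [neg_mul]
  have ev := eventually_ge_atTop (M.H (Fin.last n))
  refine ⟨hs, ⟨0, le_rfl, by simp [hd0]⟩, ?_, by fun_prop, ?_, ?_, ?_⟩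
  · rw [memLp_two_iff_integrable_sq (by fun_prop)]
    refine integrable_of_isBigO_exp_neg (mul_pos two_pos hl) (by fun_prop) ?_
    refine Asymptotics.IsBigO.of_bound (K ^ 2) (ev.mono fun z hz => le_of_eq ?_)
    rw [hK z hz, mul_pow, ← Real.exp_nat_mul, Real.norm_of_nonneg (by positivity),
      Real.norm_of_nonneg (by positivity)]
    congr 2
    push_cast
    ring
  · refine Tendsto.congr' (ev.mono fun z hz => (hK z hz).symm) ?_
    simpa using te.const_mul K
  · simpa [hd0] using (M.hasDerivWithinAt_depthState ω (k / ω) hz0 hl0.1 hl0.2).1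
  · refine ⟨fun z => ω ^ 2 * (M.depthState ω (k / ω) z).2, by fun_prop, fun z hz hzj => ?_⟩
    obtain ⟨j, hj1, hj2⟩ := M.exists_layer hz
    obtain ⟨d1, d2⟩ := M.hasDerivWithinAt_depthState ω (k / ω) hzj hj1 hj2
    have hm := (M.mu_pos j).ne'
    rw [muAt, CAt, M.layerAt_eq hj1 hj2]
    refine ⟨⟨_, d1, ?_⟩, (d2.const_mul (ω ^ 2)).congr_deriv ?_⟩
    · rw [coefA]
      field_simp
    · rw [coefB, div_pow]
      ring

lemma loveWaveExistsAt_iff {ω k : ℝ} (hω : 0 < ω) :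
    M.LoveWaveExistsAt ω k ↔ 1 / M.Cinf < k / ω ∧ M.dispersion ω k = 0 :=
  ⟨fun ⟨_, h⟩ => ⟨h.wavenumber, M.dispersion_eq_zero_of_isLoveMode hω h⟩,
    fun h => ⟨_, M.isLoveMode_depthState hω h.1 h.2⟩⟩

/-! ### Branches, cutoffs and analyticity -/

variable {M} in
-- A larger k would leave a strictly smaller finite set of zeros above it.
lemma IsBranchValue.unique {ℓ : ℕ} {ω k k' : ℝ} (h : M.IsBranchValue ℓ ω k)
    (h' : M.IsBranchValue ℓ ω k') : k = k' := by
  have key : ∀ {k k' : ℝ}, M.IsBranchValue ℓ ω k → M.IsBranchValue ℓ ω k' → ¬ k < k' := by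
    intro k k' h h' hlt
    have hfin : {x ∈ M.dispersionZeros ω | k' ≤ x}.Finite := by
      rw [← encard_lt_top_iff, h'.2]
      exact ENat.natCast_lt_top ℓ
    have hss : {x ∈ M.dispersionZeros ω | k' ≤ x} ⊂ {x ∈ M.dispersionZeros ω | k ≤ x} :=
      ssubset_iff_exists.2 ⟨fun x hx => ⟨hx.1, hlt.le.trans hx.2⟩,
        k, ⟨h.1, le_rfl⟩, fun hk => not_le.2 hlt hk.2⟩
    have := hfin.encard_lt_encard hss
    rw [h.2, h'.2] at this
    exact lt_irrefl _ this
  exact le_antisymm (not_lt.1 (key h' h)) (not_lt.1 (key h h'))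

lemma kBranch_eq {ℓ : ℕ} {ω k : ℝ} (h : M.IsBranchValue ℓ ω k) : M.kBranch ℓ ω = k := by
  have hex : ∃ k, M.IsBranchValue ℓ ω k := ⟨k, h⟩
  rw [kBranch, dif_pos hex]
  exact hex.choose_spec.unique h

/-- The frequency above which the `ℓ`-th branch gives Love waves. -/
def cutoff (ℓ : ℕ) : ℝ := sSup {ω | 0 < ω ∧ M.phase ω (1 / M.Cinf) ≤ ((ℓ : ℝ) - 1) * Real.pi}

/-- For an empty set the supremum is 0 by convention, the right cutoff for a branch present at every
positive frequency. -/
lemma cutoff_nonneg (ℓ : ℕ) : 0 ≤ M.cutoff ℓ := Real.sSup_nonneg fun _ h => h.1.le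

lemma one_div_Cinf_lt (hC : M.Czero < M.Cinf) : 1 / M.Cinf < 1 / M.Czero :=
  one_div_lt_one_div_of_lt M.Czero_pos hC

/-- The phase reaches (ℓ - 1)π at an intermediate slowness s > 1/C_∞, hence strictly exceeds it at
1/C_∞. The detour supplies the strictness missing from monotonicity in ω at 1/C_∞. -/
lemma bddAbove_cutoff (hn : 1 ≤ n) (hC : M.Czero < M.Cinf) (ℓ : ℕ) :
    BddAbove {ω | 0 < ω ∧ M.phase ω (1 / M.Cinf) ≤ ((ℓ : ℝ) - 1) * Real.pi} := by
  obtain ⟨s, hs1, hs2⟩ := exists_between (M.one_div_Cinf_lt hC)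
  obtain ⟨ω₀, h0, hω₀⟩ := M.exists_le_phase hC
    ((one_div_pos.2 M.Cinf_pos).le.trans hs1.le) hs2 (((ℓ : ℝ) - 1) * Real.pi)
  refine ⟨ω₀, fun ω hω => ?_⟩
  by_contra! hlt
  have h1 := M.phase_monotoneOn (1 / M.Cinf) h0 hω.1 hlt.le
  have h2 := M.phase_strictAntiOn hn h0 (mem_Ici.2 le_rfl) (mem_Ici.2 hs1.le) hs1
  have h3 := hω.2
  simp only at h1
  linarith

lemma lt_phase_of_cutoff_lt (hn : 1 ≤ n) (hC : M.Czero < M.Cinf) {ℓ : ℕ} {ω : ℝ}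
    (h : M.cutoff ℓ < ω) : ((ℓ : ℝ) - 1) * Real.pi < M.phase ω (1 / M.Cinf) := by
  by_contra! hle
  exact absurd (le_csSup (M.bddAbove_cutoff hn hC ℓ) ⟨(M.cutoff_nonneg ℓ).trans_lt h, hle⟩)
    (not_le.2 h)

lemma phase_cutoff (hn : 1 ≤ n) (hC : M.Czero < M.Cinf) {ℓ : ℕ} (h : 0 < M.cutoff ℓ) :
    M.phase (M.cutoff ℓ) (1 / M.Cinf) = ((ℓ : ℝ) - 1) * Real.pi := by
  have hc : ContinuousAt (fun ω => M.phase ω (1 / M.Cinf)) (M.cutoff ℓ) :=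
    (M.continuousOn_phase_left _).continuousAt (Ioi_mem_nhds h)
  refine le_antisymm ?_ ?_
  · by_contra! hlt
    have ev := (hc.eventually (lt_mem_nhds hlt)).and (Ioi_mem_nhds h)
    obtain ⟨y, hy, hy'⟩ :=
      ((ev.filter_mono (nhdsWithin_le_nhds (s := Iio (M.cutoff ℓ)))).and self_mem_nhdsWithin).exists
    -- A positive cutoff is not the default value of an empty supremum.
    have hne : {ω | 0 < ω ∧ M.phase ω (1 / M.Cinf) ≤ ((ℓ : ℝ) - 1) * Real.pi}.Nonempty := by
      by_contra! hempty
      rw [cutoff, hempty, Real.sSup_empty] at h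
      exact lt_irrefl _ h
    obtain ⟨x, hx, hyx⟩ := exists_lt_of_lt_csSup hne hy'
    have h1 := M.phase_monotoneOn (1 / M.Cinf) hy.2 hx.1 hyx.le
    have h2 := hx.2
    have h3 := hy.1
    simp only at h1
    linarith
  · by_contra! hlt
    have ev := hc.eventually (gt_mem_nhds hlt)
    obtain ⟨y, hy, hy'⟩ :=
      ((ev.filter_mono (nhdsWithin_le_nhds (s := Ioi (M.cutoff ℓ)))).and self_mem_nhdsWithin).exists
    exact lt_asymm hy (M.lt_phase_of_cutoff_lt hn hC hy')

lemma cutoff_lt_of_lt_phase (hn : 1 ≤ n) (hC : M.Czero < M.Cinf) {ℓ : ℕ} {ω : ℝ} (hω : 0 < ω)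
    (h : ((ℓ : ℝ) - 1) * Real.pi < M.phase ω (1 / M.Cinf)) : M.cutoff ℓ < ω := by
  by_contra! hle
  have h0 : 0 < M.cutoff ℓ := hω.trans_le hle
  have h1 := M.phase_monotoneOn (1 / M.Cinf) hω h0 hle
  simp only [M.phase_cutoff hn hC h0] at h1
  linarith

lemma phase_surjOn (hC : M.Czero < M.Cinf) {ω s v : ℝ} (hω : 0 < ω) (hs : s ≤ 1 / M.Czero)
    (hv : 0 ≤ v) (hvs : v ≤ M.phase ω s) : ∃ t ∈ Icc s (1 / M.Czero), M.phase ω t = v :=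
  intermediate_value_Icc' hs (M.continuous_phase_right ω).continuousOn
    ⟨(M.phase_Czero_neg hC hω).le.trans hv, hvs⟩

lemma lt_Czero_of_phase_nonneg (hn : 1 ≤ n) (hC : M.Czero < M.Cinf) {ω s : ℝ} (hω : 0 < ω)
    (hs : 1 / M.Cinf ≤ s) (h : 0 ≤ M.phase ω s) : s < 1 / M.Czero := by
  rw [← (M.phase_strictAntiOn hn hω).lt_iff_gt (M.one_div_Cinf_lt hC).le hs]
  exact (M.phase_Czero_neg hC hω).trans_le h

lemma nonneg_of_phase_eq {ω s : ℝ} {m : ℤ} (hω : 0 < ω) (h : M.phase ω s = m * Real.pi) :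
    0 ≤ m := by
  have h1 := M.neg_pi_lt_phase hω s
  rw [h] at h1
  have : (-1 : ℝ) < m := by nlinarith [Real.pi_pos]
  have : (-1 : ℤ) < m := by exact_mod_cast this
  omega

/-- The phase maps the zeros k' ≥ ω s bijectively onto 0, π, …, (ℓ - 1)π, so there are ℓ of them. -/
lemma isBranchValue_of_phase_eq (hn : 1 ≤ n) (hC : M.Czero < M.Cinf) {ℓ : ℕ} (hℓ : 1 ≤ ℓ)
    {ω s : ℝ} (hω : 0 < ω) (hs : 1 / M.Cinf ≤ s) (h : M.phase ω s = ((ℓ : ℝ) - 1) * Real.pi) :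
    M.IsBranchValue ℓ ω (ω * s) := by
  have hc0 : 0 < 1 / M.Cinf := one_div_pos.2 M.Cinf_pos
  have hℓ' : (1 : ℝ) ≤ ℓ := by exact_mod_cast hℓ
  have anti := M.phase_strictAntiOn hn hω
  have hsd := M.lt_Czero_of_phase_nonneg hn hC hω hs
    (h ▸ mul_nonneg (sub_nonneg.2 hℓ') Real.pi_pos.le)
  have mem : ∀ {t : ℝ}, 1 / M.Cinf ≤ t → ∀ m : ℤ, M.phase ω t = m * Real.pi →
      ω * t ∈ M.dispersionZeros ω := fun {t} ht m hm => by
    have h0 : 0 ≤ ω * t := mul_nonneg hω.le (hc0.le.trans ht)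
    refine ⟨h0, (M.dispersion_eq_zero_iff hω h0).2 ?_⟩
    rw [mul_div_cancel_left₀ _ hω.ne']
    exact ⟨ht, m, hm⟩
  refine ⟨mem hs ((ℓ : ℤ) - 1) (by push_cast; exact h), ?_⟩
  have inj : InjOn (fun k => M.phase ω (k / ω)) {k' ∈ M.dispersionZeros ω | ω * s ≤ k'} := by
    intro k hk k' hk' hkk
    have h1 := ((M.dispersion_eq_zero_iff hω hk.1.1).1 hk.1.2).1
    have h2 := ((M.dispersion_eq_zero_iff hω hk'.1.1).1 hk'.1.2).1
    exact (div_left_inj' hω.ne').1 (anti.injOn h1 h2 hkk)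
  have himg : (fun k => M.phase ω (k / ω)) '' {k' ∈ M.dispersionZeros ω | ω * s ≤ k'} =
      (fun i : ℕ => (i : ℝ) * Real.pi) '' (Finset.range ℓ : Set ℕ) := by
    ext v
    constructor
    · rintro ⟨k, ⟨hk, hle⟩, rfl⟩
      obtain ⟨h1, m, hm⟩ := (M.dispersion_eq_zero_iff hω hk.1).1 hk.2
      have hm0 := M.nonneg_of_phase_eq hω hm
      have h2 : s ≤ k / ω := by rwa [le_div_iff₀' hω]
      have h3 := anti.antitoneOn hs h1 h2
      rw [hm, h] at h3
      have h4 : (m : ℝ) ≤ (ℓ : ℝ) - 1 := le_of_mul_le_mul_right h3 Real.pi_pos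
      have h5 : m ≤ (ℓ : ℤ) - 1 := by exact_mod_cast h4
      obtain ⟨i, rfl⟩ := Int.eq_ofNat_of_zero_le hm0
      exact ⟨i, by simp; omega, by simpa using hm.symm⟩
    · rintro ⟨i, hi, rfl⟩
      have hi' : i + 1 ≤ ℓ := by simpa using hi
      have hi'' : (i : ℝ) + 1 ≤ ℓ := by exact_mod_cast hi'
      -- Each lower multiple is attained between s and 1/C_0, because the phase is negative at
      -- 1/C_0.
      obtain ⟨t, ht, hti⟩ := M.phase_surjOn hC hω hsd.le
        (mul_nonneg (Nat.cast_nonneg i) Real.pi_pos.le)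
        (h ▸ mul_le_mul_of_nonneg_right (by linarith) Real.pi_pos.le)
      refine ⟨ω * t, ⟨mem (hs.trans ht.1) i (by simpa using hti),
        mul_le_mul_of_nonneg_left ht.1 hω.le⟩, ?_⟩
      simp only [mul_div_cancel_left₀ _ hω.ne', hti]
  rw [← inj.encard_image, himg, Function.Injective.encard_image, encard_coe_eq_coe_finsetCard,
    Finset.card_range]
  intro i j hij
  exact Nat.cast_injective (mul_right_cancel₀ Real.pi_ne_zero hij)

/-- The slowness of the `ℓ`-th branch is the solution of `phase = (ℓ - 1) π`. -/
lemma kBranch_div_eq (hn : 1 ≤ n) (hC : M.Czero < M.Cinf) {ℓ : ℕ} (hℓ : 1 ≤ ℓ)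
    {ω s : ℝ} (hω : 0 < ω) (hs : 1 / M.Cinf ≤ s) (h : M.phase ω s = ((ℓ : ℝ) - 1) * Real.pi) :
    M.kBranch ℓ ω / ω = s := by
  rw [M.kBranch_eq (M.isBranchValue_of_phase_eq hn hC hℓ hω hs h), mul_div_cancel_left₀ _ hω.ne']

lemma exists_slowness (hn : 1 ≤ n) (hC : M.Czero < M.Cinf) {ℓ : ℕ} (hℓ : 1 ≤ ℓ) {ω : ℝ}
    (h : M.cutoff ℓ < ω) :
    ∃ s ∈ Ioo (1 / M.Cinf) (1 / M.Czero), M.phase ω s = ((ℓ : ℝ) - 1) * Real.pi := by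
  have hω := (M.cutoff_nonneg ℓ).trans_lt h
  have hℓ' : (1 : ℝ) ≤ ℓ := by exact_mod_cast hℓ
  exact intermediate_value_Ioo' (M.one_div_Cinf_lt hC).le (M.continuous_phase_right ω).continuousOn
    ⟨(M.phase_Czero_neg hC hω).trans_le (mul_nonneg (sub_nonneg.2 hℓ') Real.pi_pos.le),
      M.lt_phase_of_cutoff_lt hn hC h⟩

lemma kBranch_spec (hn : 1 ≤ n) (hC : M.Czero < M.Cinf) {ℓ : ℕ} (hℓ : 1 ≤ ℓ) {ω : ℝ}
    (h : M.cutoff ℓ < ω) :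
    M.kBranch ℓ ω / ω ∈ Ioo (1 / M.Cinf) (1 / M.Czero) ∧
      M.phase ω (M.kBranch ℓ ω / ω) = ((ℓ : ℝ) - 1) * Real.pi := by
  obtain ⟨s, hs, hp⟩ := M.exists_slowness hn hC hℓ h
  rw [M.kBranch_div_eq hn hC hℓ ((M.cutoff_nonneg ℓ).trans_lt h) hs.1.le hp]
  exact ⟨hs, hp⟩

lemma isBranchValue_kBranch (hn : 1 ≤ n) (hC : M.Czero < M.Cinf) {ℓ : ℕ} (hℓ : 1 ≤ ℓ) {ω : ℝ}
    (h : M.cutoff ℓ < ω) : M.IsBranchValue ℓ ω (M.kBranch ℓ ω) := by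
  have hω := (M.cutoff_nonneg ℓ).trans_lt h
  obtain ⟨hs, hp⟩ := M.kBranch_spec hn hC hℓ h
  simpa [mul_div_cancel₀ _ hω.ne'] using M.isBranchValue_of_phase_eq hn hC hℓ hω hs.1.le hp

/-- Raising ω raises the phase at the old slowness; only a larger slowness brings it back to (ℓ -
1)π. -/
lemma strictMonoOn_slowness (hn : 1 ≤ n) (hC : M.Czero < M.Cinf) {ℓ : ℕ} (hℓ : 1 ≤ ℓ) :
    StrictMonoOn (fun ω => M.kBranch ℓ ω / ω) (Ioi (M.cutoff ℓ)) := by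
  intro ω hω ω' hω' hlt
  have h0 := M.cutoff_nonneg ℓ
  obtain ⟨hs, hp⟩ := M.kBranch_spec hn hC hℓ hω
  obtain ⟨hs', hp'⟩ := M.kBranch_spec hn hC hℓ hω'
  have h1 := M.phase_strictMonoOn hs.1 (h0.trans_lt hω) (h0.trans_lt hω') hlt
  simp only [hp, ← hp'] at h1
  exact ((M.phase_strictAntiOn hn (h0.trans_lt hω')).lt_iff_gt hs'.1.le hs.1.le).1 h1

/-- Surjectivity is the intermediate value theorem in ω at fixed s. -/
lemma bijOn_slowness (hn : 1 ≤ n) (hC : M.Czero < M.Cinf) {ℓ : ℕ} (hℓ : 1 ≤ ℓ) :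
    BijOn (fun ω => M.kBranch ℓ ω / ω) (Ioi (M.cutoff ℓ)) (Ioo (1 / M.Cinf) (1 / M.Czero)) := by
  refine ⟨fun ω hω => (M.kBranch_spec hn hC hℓ hω).1, (M.strictMonoOn_slowness hn hC hℓ).injOn,
    fun s hs => ?_⟩
  have hℓ' : (1 : ℝ) ≤ ℓ := by exact_mod_cast hℓ
  obtain ⟨ω₁, h1, hω₁⟩ := M.exists_phase_neg hs.1
  obtain ⟨ω₂, h2, hω₂⟩ := M.exists_le_phase hC ((one_div_pos.2 M.Cinf_pos).le.trans hs.1.le) hs.2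
    (((ℓ : ℝ) - 1) * Real.pi)
  obtain ⟨ω, hω, hp⟩ := isPreconnected_Ioi.intermediate_value h1 h2 (M.continuousOn_phase_left s)
    ⟨hω₁.le.trans (mul_nonneg (sub_nonneg.2 hℓ') Real.pi_pos.le), hω₂⟩
  refine ⟨ω, M.cutoff_lt_of_lt_phase hn hC hω ?_, M.kBranch_div_eq hn hC hℓ hω hs.1.le hp⟩
  -- The phase at 1/C_∞ is strictly larger than at s, which puts ω above the cutoff.
  exact hp ▸ M.phase_strictAntiOn hn hω (mem_Ici.2 le_rfl) hs.1.le hs.1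

/-- The derivative of the phase in s is negative, so the implicit function theorem applies. -/
lemma analyticOnNhd_slowness (hn : 1 ≤ n) (hC : M.Czero < M.Cinf) {ℓ : ℕ} (hℓ : 1 ≤ ℓ) :
    AnalyticOnNhd ℝ (fun ω => M.kBranch ℓ ω / ω) (Ioi (M.cutoff ℓ)) := by
  intro ω₀ hω₀
  have h0 : 0 < ω₀ := (M.cutoff_nonneg ℓ).trans_lt hω₀
  obtain ⟨hs, hp⟩ := M.kBranch_spec hn hC hℓ hω₀
  set s₀ := M.kBranch ℓ ω₀ / ω₀
  have han := M.analyticAt_phase h0.ne' hs.1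
  have cd : ContDiffAt ℝ ⊤ (fun q : ℝ × ℝ => M.phase q.1 q.2) (ω₀, s₀) := han.contDiffAt
  obtain ⟨d, hd, hder⟩ := M.exists_hasDerivAt_phase_neg hn h0 hs.1
  have hD : (fderiv ℝ (fun q : ℝ × ℝ => M.phase q.1 q.2) (ω₀, s₀)) (0, 1) = d := by
    have h1 : HasDerivAt (fun s : ℝ => (ω₀, s)) ((0 : ℝ), (1 : ℝ)) s₀ :=
      (hasDerivAt_const s₀ ω₀).prodMk (hasDerivAt_id s₀)
    exact (HasFDerivAt.comp_hasDerivAt s₀ (f := fun s : ℝ => (ω₀, s))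
      han.differentiableAt.hasFDerivAt h1).unique hder
  have hDs : ∀ c : ℝ,
      (fderiv ℝ (fun q : ℝ × ℝ => M.phase q.1 q.2) (ω₀, s₀)) (0, c) = c * d := fun c => by
    rw [show ((0 : ℝ), c) = c • ((0 : ℝ), (1 : ℝ)) by simp, map_smul, hD, smul_eq_mul]
  have hinv : (fderiv ℝ (fun q : ℝ × ℝ => M.phase q.1 q.2) (ω₀, s₀) ∘L
      .inr ℝ ℝ ℝ).IsInvertible := by
    refine ContinuousLinearMap.IsInvertible.of_inverse (g := d⁻¹ • .id ℝ ℝ) ?_ ?_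
    · ext
      simpa [hDs] using inv_mul_cancel₀ hd.ne
    · ext
      simpa [hDs] using inv_mul_cancel₀ hd.ne
  have hψ : ContDiffAt ℝ ⊤ (cd.implicitFunction (by simp) hinv) ω₀ :=
    cd.contDiffAt_implicitFunction (by simp) hinv
  refine hψ.analyticAt.congr ?_
  have e0 : cd.implicitFunction (by simp) hinv ω₀ = s₀ :=
    cd.implicitFunction_apply_self (by simp) hinv
  -- The implicit function must stay above 1/C_∞, where solutions of the phase equation are unique
  -- and hence equal to the branch.
  have e1 : ∀ᶠ ω in 𝓝 ω₀, 1 / M.Cinf < cd.implicitFunction (by simp) hinv ω :=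
    hψ.continuousAt.eventually (lt_mem_nhds (by rw [e0]; exact hs.1))
  filter_upwards [e1, cd.eventually_apply_implicitFunction (by simp) hinv, Ioi_mem_nhds h0]
    with ω h1 h2 h3
  exact (M.kBranch_div_eq hn hC hℓ h3 h1.le (h2.trans hp)).symm

lemma kBranch_cutoff (hn : 1 ≤ n) (hC : M.Czero < M.Cinf) {ℓ : ℕ} (hℓ : 1 ≤ ℓ)
    (h : 0 < M.cutoff ℓ) : M.IsBranchValue ℓ (M.cutoff ℓ) (M.kBranch ℓ (M.cutoff ℓ)) ∧
      M.kBranch ℓ (M.cutoff ℓ) = M.cutoff ℓ / M.Cinf := by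
  have hb := M.isBranchValue_of_phase_eq hn hC hℓ h le_rfl (M.phase_cutoff hn hC h)
  rw [M.kBranch_eq hb]
  exact ⟨hb, by rw [mul_one_div]⟩

lemma loveWaveExistsAt_iff_exists_branch (hn : 1 ≤ n) (hC : M.Czero < M.Cinf) {ω k : ℝ}
    (hω : 0 < ω) :
    M.LoveWaveExistsAt ω k ↔ ∃ ℓ : ℕ, 1 ≤ ℓ ∧ M.cutoff ℓ < ω ∧ k = M.kBranch ℓ ω := by
  rw [M.loveWaveExistsAt_iff hω]
  constructor
  · rintro ⟨hs, hk⟩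
    have hk0 : 0 ≤ k := ((div_pos_iff_of_pos_right hω).1
      ((one_div_pos.2 M.Cinf_pos).trans hs)).le
    obtain ⟨-, m, hm⟩ := (M.dispersion_eq_zero_iff hω hk0).1 hk
    obtain ⟨i, rfl⟩ := Int.eq_ofNat_of_zero_le (M.nonneg_of_phase_eq hω hm)
    -- The multiple iπ belongs to the branch ℓ = i + 1.
    have hp : M.phase ω (k / ω) = (((i + 1 : ℕ) : ℝ) - 1) * Real.pi := by simpa using hm
    refine ⟨i + 1, by omega, M.cutoff_lt_of_lt_phase hn hC hω ?_, ?_⟩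
    · exact hp ▸ M.phase_strictAntiOn hn hω (mem_Ici.2 le_rfl) hs.le hs
    · rw [M.kBranch_eq (M.isBranchValue_of_phase_eq hn hC (by omega) hω hs.le hp),
        mul_div_cancel₀ _ hω.ne']
  · rintro ⟨ℓ, hℓ, hlt, rfl⟩
    exact ⟨(M.kBranch_spec hn hC hℓ hlt).1.1, (M.isBranchValue_kBranch hn hC hℓ hlt).1.2⟩

end LayeredMedium
end

theorem mainTheorem1 (n : ℕ) (hn : 1 ≤ n) (M : LayeredMedium n)
    (hC : M.Czero < M.Cinf) (hsep : 3 ≤ n → M.Czero < M.Csorted 1) :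
    ∃ Ω : ℕ → ℝ,
      (∀ ℓ : ℕ, 1 ≤ ℓ →
        0 ≤ Ω ℓ ∧
        (∀ ω : ℝ, Ω ℓ < ω → M.IsBranchValue ℓ ω (M.kBranch ℓ ω)) ∧
        AnalyticOnNhd ℝ (fun ω : ℝ => M.kBranch ℓ ω / ω) (Ioi (Ω ℓ)) ∧
        BijOn (fun ω : ℝ => M.kBranch ℓ ω / ω) (Ioi (Ω ℓ)) (Ioo (1 / M.Cinf) (1 / M.Czero)) ∧
        StrictMonoOn (fun ω : ℝ => M.kBranch ℓ ω / ω) (Ioi (Ω ℓ)) ∧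
        (0 < Ω ℓ →
          M.IsBranchValue ℓ (Ω ℓ) (M.kBranch ℓ (Ω ℓ)) ∧
          M.kBranch ℓ (Ω ℓ) = Ω ℓ / M.Cinf)) ∧
      (∀ ω k : ℝ, 0 < ω →
        (M.LoveWaveExistsAt ω k ↔ ∃ ℓ : ℕ, 1 ≤ ℓ ∧ Ω ℓ < ω ∧ k = M.kBranch ℓ ω)) := by
  exact ⟨M.cutoff, fun ℓ hℓ => ⟨M.cutoff_nonneg ℓ,
    fun _ h => M.isBranchValue_kBranch hn hC hℓ h, M.analyticOnNhd_slowness hn hC hℓ,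
    M.bijOn_slowness hn hC hℓ, M.strictMonoOn_slowness hn hC hℓ, M.kBranch_cutoff hn hC hℓ⟩,
    fun _ _ hω => M.loveWaveExistsAt_iff_exists_branch hn hC hω⟩
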